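/- Let $k$ be an algebraically closed field of characteristic $0$, and let $\mathcal D$ (the double of the Jordan plane) be the associative unital $k$-algebra with generators $u, v, \zeta, g^{\pm 1}, x, y$ and relations $$g g^{-1} = g^{-1} g = 1,\quad \zeta g = g\zeta,\quad gx = xg,\quad gy = yg + xg,\quad \zeta y = y\zeta + y,\quad \zeta x = x\zeta + x,$$ $$ug = gu,\quad vg = gv + gu,\quad v\zeta = \zeta v + v,\quad u\zeta = \zeta u + u,\quad yx = xy - \tfrac12 x^2,\quad vu = uv - \tfrac12 u^2,$$ $$ux = xu,\quad vx = xv + (1-g) + xu,\quad uy = yu + (1-g),\quad vy = yv - g\zeta + yu.$$ Put $q = ux + 2(1+g)$, $z = q^2 g^{-1}$ and $s = xv + uy + (-\tfrac12 ux + g - 1)\zeta - 2(1+g)$. Then $q$ is normal in $\mathcal D$, that is, $\mathcal D q = q\mathcal D$. Let $\mathcal D'$ be the Ore localization of $\mathcal D$ at the multiplicative set generated by $x$ and $q$, and put $z' = q^{-1}s \in \mathcal D'$. For a commutative ring $R$, let $A_2(R)$ be the Weyl algebra, i.e. the $R$-algebra generated by $q_1, q_2, p_1, p_2$ with relations $p_i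 q_i - q_i p_i = 1$ for $i = 1, 2$, all other pairs of generators commuting, and let $A_2'(R)$ be its localization at the multiplicative set generated by $q_1$ and $q_2$. Then $z$ is invertible in $\mathcal D'$ with inverse $g q^{-2}$; moreover $z' = q^{-1}s = s q^{-1}$, and $z'$ is central in $\mathcal D'$. The center of $\mathcal D'$ is the subalgebra $S = k[z^{\pm 1}, z']$ generated by $z, z^{-1}, z'$, where $z$ and $z'$ are algebraically independent over $k$ (so $S$ is the ring of polynomials in $z'$ over the Laurent polynomial ring in $z$). There is an isomorphism of $k$-algebras $\mathcal D' \cong A_2'(S)$ that restricts to the identity on $S$. -/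

import Mathlib

open Polynomial

/-! ## Localization at locally ad-nilpotent elements -/

/-- `s` is locally ad-nilpotent: for every `a`, iterating `a ↦ s a - a s` gives `0`. -/
def IsLocallyAdNilpotent {A : Type*} [Ring A] (s : A) : Prop :=
  ∀ a : A, ∃ n : ℕ, (fun b : A => s * b - b * s)^[n] a = 0

theorem iterate_ad_zero {A : Type*} [Ring A] (s : A) (n : ℕ) :
    (fun b : A => s * b - b * s)^[n] 0 = 0 :=
  Function.iterate_fixed (by simp) n

theorem iterate_ad_mono {A : Type*} [Ring A] (s : A) {m n : ℕ} (h : m ≤ n) {a : A}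
    (ha : (fun b : A => s * b - b * s)^[m] a = 0) :
    (fun b : A => s * b - b * s)^[n] a = 0 := by
  obtain ⟨j, rfl⟩ := Nat.exists_eq_add_of_le' h
  rw [Function.iterate_add_apply, ha, iterate_ad_zero]

theorem iterate_ad_add {A : Type*} [Ring A] (s : A) (n : ℕ) (a b : A) :
    (fun b : A => s * b - b * s)^[n] (a + b) =
      (fun b : A => s * b - b * s)^[n] a + (fun b : A => s * b - b * s)^[n] b := by
  induction n generalizing a b with
  | zero => rfl
  | succ n ih =>
    simp only [Function.iterate_succ_apply]
    rw [← ih]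
    congr 1
    noncomm_ring

theorem iterate_ad_mul {A : Type*} [Ring A] (s : A) (N : ℕ) : ∀ (m n : ℕ) (a b : A), m + n = N →
    (fun b : A => s * b - b * s)^[m] a = 0 → (fun b : A => s * b - b * s)^[n] b = 0 →
    (fun b : A => s * b - b * s)^[N] (a * b) = 0 := by
  induction N with
  | zero =>
    intro m n a b h ha _
    obtain rfl : m = 0 := by omega
    have ha' : a = 0 := ha
    simp [ha']
  | succ N ih =>
    intro m n a b h ha hb
    rcases m with _ | m
    · have ha' : a = 0 := ha
      rw [ha', zero_mul, iterate_ad_zero]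
    rcases n with _ | n
    · have hb' : b = 0 := hb
      rw [hb', mul_zero, iterate_ad_zero]
    rw [Function.iterate_succ_apply]
    have key : s * (a * b) - a * b * s = (s * a - a * s) * b + a * (s * b - b * s) := by
      noncomm_ring
    rw [key, iterate_ad_add, ih m (n + 1) _ _ (by omega) ha hb,
      ih (m + 1) n _ _ (by omega) ha hb, add_zero]

theorem exists_pow_mul_of_iterate_ad {A : Type*} [Ring A] (s : A) (n : ℕ) :
    ∀ a : A, (fun b : A => s * b - b * s)^[n] a = 0 → ∃ r, s ^ n * a = r * s := by
  induction n with
  | zero =>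
    intro a ha
    have ha' : a = 0 := ha
    exact ⟨0, by simp [ha']⟩
  | succ n ih =>
    intro a ha
    obtain ⟨r, hr⟩ := ih (s * a - a * s) ha
    refine ⟨s ^ n * a + r, ?_⟩
    rw [add_mul, ← hr, pow_succ]
    noncomm_ring

theorem pow_mul_eq_zero_of_iterate_ad {A : Type*} [Ring A] (s : A) (n : ℕ) :
    ∀ a : A, (fun b : A => s * b - b * s)^[n] a = 0 → a * s = 0 → s ^ n * a = 0 := by
  induction n with
  | zero =>
    intro a ha _
    have ha' : a = 0 := ha
    simp [ha']
  | succ n ih =>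
    intro a ha h0
    have h1 := ih (s * a - a * s) ha (by rw [h0, sub_zero, mul_assoc, h0, mul_zero])
    rwa [h0, sub_zero, ← mul_assoc, ← pow_succ] at h1

/-- A multiplicative set generated by locally ad-nilpotent elements satisfies the Ore
condition. -/
theorem nonempty_oreSet_closure {A : Type*} [Ring A] (T : Set A)
    (hT : ∀ s ∈ T, IsLocallyAdNilpotent s) :
    Nonempty (OreLocalization.OreSet (Submonoid.closure T)) := by
  have key : ∀ s ∈ Submonoid.closure T,
      (∀ r : A, ∃ s' ∈ Submonoid.closure T, ∃ r' : A, s' * r = r' * s) ∧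
      (∀ r : A, r * s = 0 → ∃ s' ∈ Submonoid.closure T, s' * r = 0) := by
    intro s hs
    induction hs using Submonoid.closure_induction with
    | mem s hs =>
      refine ⟨fun r => ?_, fun r h0 => ?_⟩
      · obtain ⟨n, hn⟩ := hT s hs r
        exact ⟨s ^ n, pow_mem (Submonoid.subset_closure hs) n,
          exists_pow_mul_of_iterate_ad s n r hn⟩
      · obtain ⟨n, hn⟩ := hT s hs r
        exact ⟨s ^ n, pow_mem (Submonoid.subset_closure hs) n,
          pow_mul_eq_zero_of_iterate_ad s n r hn h0⟩
    | one => exact ⟨fun r => ⟨1, one_mem _, r, by simp⟩, fun r h => ⟨1, one_mem _, by simpa using h⟩⟩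
    | mul a b _ _ iha ihb =>
      refine ⟨fun r => ?_, fun r h0 => ?_⟩
      · obtain ⟨s₁, hs₁, r₁, h₁⟩ := ihb.1 r
        obtain ⟨s₂, hs₂, r₂, h₂⟩ := iha.1 r₁
        refine ⟨s₂ * s₁, mul_mem hs₂ hs₁, r₂, ?_⟩
        rw [mul_assoc, h₁, ← mul_assoc, h₂, mul_assoc]
      · obtain ⟨s₁, hs₁, h₁⟩ := ihb.2 (r * a) (by rw [mul_assoc, h0])
        obtain ⟨s₂, hs₂, h₂⟩ := iha.2 (s₁ * r) (by rw [mul_assoc, h₁])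
        exact ⟨s₂ * s₁, mul_mem hs₂ hs₁, by rw [mul_assoc, h₂]⟩
  choose! h1 h2 using key
  choose! d hd n hn using h1
  refine ⟨⟨fun r₁ r₂ s h => ?_, fun r s => n s r, fun r s => ⟨d s r, hd s s.2 r⟩,
    fun r s => hn s s.2 r⟩⟩
  obtain ⟨s', hs', h'⟩ := h2 s s.2 (r₁ - r₂) (by rw [sub_mul, h, sub_self])
  exact ⟨⟨s', hs'⟩, by rwa [mul_sub, sub_eq_zero] at h'⟩

theorem iterate_two_ad {A : Type*} [Ring A] {a b c : A} (h : a * b - b * a = c)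
    (hc : Commute a c) : (fun b : A => a * b - b * a)^[2] b = 0 := by
  simp only [Function.iterate_succ, Function.iterate_zero, Function.comp, id, h]
  rw [hc.eq, sub_self]

/-- In a quotient of a free algebra, local ad-nilpotency may be checked on the generators. -/
theorem isLocallyAdNilpotent_of_generators {R X A : Type*} [CommRing R] [Ring A] [Algebra R A]
    (π : FreeAlgebra R X →ₐ[R] A) (hπ : Function.Surjective π) (s : A)
    (h : ∀ i : X, ∃ n : ℕ, (fun b => s * b - b * s)^[n] (π (FreeAlgebra.ι R i)) = 0) :
    IsLocallyAdNilpotent s := by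
  intro a
  obtain ⟨f, rfl⟩ := hπ a
  induction f using FreeAlgebra.induction with
  | grade0 c =>
    refine ⟨1, ?_⟩
    simp only [AlgHom.commutes, Function.iterate_one]
    rw [Algebra.commutes, sub_self]
  | grade1 i => exact h i
  | mul a b iha ihb =>
    obtain ⟨m, hm⟩ := iha
    obtain ⟨n, hn⟩ := ihb
    exact ⟨m + n, by rw [map_mul]; exact iterate_ad_mul s _ m n _ _ rfl hm hn⟩
  | add a b iha ihb =>
    obtain ⟨m, hm⟩ := iha
    obtain ⟨n, hn⟩ := ihb
    refine ⟨m + n, ?_⟩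
    rw [map_add, iterate_ad_add, iterate_ad_mono s (Nat.le_add_right m n) hm,
      iterate_ad_mono s (Nat.le_add_left n m) hn, add_zero]

/-- `a` is a normal element of the ring `A`: `A a = a A`. -/
def IsNormalElement {A : Type*} [Ring A] (a : A) : Prop :=
  Set.range (fun b : A => b * a) = Set.range (fun b : A => a * b)

/-! ## The algebra `𝒟`, the double of the Jordan plane -/

namespace JordanDouble

/-- The generators `u, v, ζ, g, g⁻¹, x, y`. -/
inductive Gen : Type
  | u | v | zeta | g | ginv | x | y

section Presentation

variable (k : Type*) [Field k]

/-- A generator as an element of the free algebra. -/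
def free (i : Gen) : FreeAlgebra k Gen := FreeAlgebra.ι k i

/-- The defining relations of the double of the Jordan plane. -/
inductive Rel : FreeAlgebra k Gen → FreeAlgebra k Gen → Prop
  | g_ginv : Rel (free k .g * free k .ginv) 1
  | ginv_g : Rel (free k .ginv * free k .g) 1
  | zeta_g : Rel (free k .zeta * free k .g) (free k .g * free k .zeta)
  | g_x : Rel (free k .g * free k .x) (free k .x * free k .g)
  | g_y : Rel (free k .g * free k .y) (free k .y * free k .g + free k .x * free k .g)
  | zeta_y : Rel (free k .zeta * free k .y) (free k .y * free k .zeta + free k .y)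
  | zeta_x : Rel (free k .zeta * free k .x) (free k .x * free k .zeta + free k .x)
  | u_g : Rel (free k .u * free k .g) (free k .g * free k .u)
  | v_g : Rel (free k .v * free k .g) (free k .g * free k .v + free k .g * free k .u)
  | v_zeta : Rel (free k .v * free k .zeta) (free k .zeta * free k .v + free k .v)
  | u_zeta : Rel (free k .u * free k .zeta) (free k .zeta * free k .u + free k .u)
  | y_x : Rel (free k .y * free k .x)
      (free k .x * free k .y - (1 / 2 : k) • (free k .x) ^ 2)
  | v_u : Rel (free k .v * free k .u)
      (free k .u * free k .v - (1 / 2 : k) • (free k .u) ^ 2)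
  | u_x : Rel (free k .u * free k .x) (free k .x * free k .u)
  | v_x : Rel (free k .v * free k .x)
      (free k .x * free k .v + (1 - free k .g) + free k .x * free k .u)
  | u_y : Rel (free k .u * free k .y) (free k .y * free k .u + (1 - free k .g))
  | v_y : Rel (free k .v * free k .y)
      (free k .y * free k .v - free k .g * free k .zeta + free k .y * free k .u)

end Presentation

end JordanDouble

/-- The `k`-algebra `𝒟` presented by `u, v, ζ, g^{±1}, x, y` and the above relations. -/
def JordanDouble (k : Type*) [Field k] : Type _ := RingQuot (JordanDouble.Rel k)

namespace JordanDouble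

section Elements

variable (k : Type*) [Field k]

noncomputable instance : Ring (JordanDouble k) :=
  inferInstanceAs (Ring (RingQuot (Rel k)))

noncomputable instance : Algebra k (JordanDouble k) :=
  inferInstanceAs (Algebra k (RingQuot (Rel k)))

/-- The quotient map from the free algebra to `𝒟`. -/
noncomputable def mk : FreeAlgebra k Gen →ₐ[k] JordanDouble k :=
  RingQuot.mkAlgHom k (Rel k)

theorem mk_surjective : Function.Surjective (mk k) :=
  RingQuot.mkAlgHom_surjective k (Rel k)

/-- A generator as an element of `𝒟`. -/
noncomputable def gen (i : Gen) : JordanDouble k := mk k (free k i)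

/-- `q = u x + 2 (1 + g)`. -/
noncomputable def q : JordanDouble k := gen k .u * gen k .x + 2 * (1 + gen k .g)

/-- `z = q² g⁻¹`. -/
noncomputable def z : JordanDouble k := q k ^ 2 * gen k .ginv

/-- `s = x v + u y + (-½ u x + g - 1) ζ - 2 (1 + g)`. -/
noncomputable def s : JordanDouble k :=
  gen k .x * gen k .v + gen k .u * gen k .y
    + (-((1 / 2 : k) • (gen k .u * gen k .x)) + gen k .g - 1) * gen k .zeta
    - 2 * (1 + gen k .g)

theorem rel_eq {a b : FreeAlgebra k Gen} (h : Rel k a b) :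
    mk k a = mk k b :=
  RingQuot.mkAlgHom_rel k h

theorem commute_ginv {a : JordanDouble k} (h : Commute a (gen k .g)) :
    Commute a (gen k .ginv) := by
  have h1 : gen k .g * gen k .ginv = 1 := by
    simpa [gen] using rel_eq k Rel.g_ginv
  have h2 : gen k .ginv * gen k .g = 1 := by
    simpa [gen] using rel_eq k Rel.ginv_g
  let U : (JordanDouble k)ˣ := ⟨gen k .g, gen k .ginv, h1, h2⟩
  exact Commute.units_inv_right (u := U) h

theorem x_isLocallyAdNilpotent : IsLocallyAdNilpotent (gen k .x) := by
  have gx : gen k .g * gen k .x = gen k .x * gen k .g := by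
    simpa [gen] using rel_eq k Rel.g_x
  have ux : gen k .u * gen k .x = gen k .x * gen k .u := by
    simpa [gen] using rel_eq k Rel.u_x
  have zx : gen k .zeta * gen k .x = gen k .x * gen k .zeta + gen k .x := by
    simpa [gen] using rel_eq k Rel.zeta_x
  have yx : gen k .y * gen k .x = gen k .x * gen k .y - (1 / 2 : k) • gen k .x ^ 2 := by
    simpa [gen] using rel_eq k Rel.y_x
  have vx : gen k .v * gen k .x
      = gen k .x * gen k .v + (1 - gen k .g) + gen k .x * gen k .u := by
    simpa [gen] using rel_eq k Rel.v_x
  apply isLocallyAdNilpotent_of_generators (mk k) (mk_surjective k)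
  intro i
  change ∃ n : ℕ, (fun b => gen k .x * b - b * gen k .x)^[n] (gen k i) = 0
  cases i with
  | u => exact ⟨1, by simp [ux]⟩
  | g => exact ⟨1, by simp [gx]⟩
  | ginv => exact ⟨1, by simp [(commute_ginv k (a := gen k .x) gx.symm).eq]⟩
  | x => exact ⟨1, by simp⟩
  | zeta =>
    have h : gen k .x * gen k .zeta - gen k .zeta * gen k .x = -gen k .x := by rw [zx]; abel
    exact ⟨2, iterate_two_ad h (Commute.refl _).neg_right⟩
  | y =>
    refine ⟨2, ?_⟩
    simp only [Function.iterate_succ, Function.iterate_zero, Function.comp, id, yx]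
    simp [pow_succ, mul_assoc]
  | v =>
    refine ⟨2, ?_⟩
    have h : gen k .x * gen k .v - gen k .v * gen k .x
        = gen k .g - 1 - gen k .x * gen k .u := by rw [vx]; abel
    simp only [Function.iterate_succ, Function.iterate_zero, Function.comp, id, h]
    simp only [mul_sub, sub_mul, gx, mul_assoc, ux]
    simp

theorem q_commute_u : Commute (q k) (gen k .u) := by
  have gu : Commute (gen k .g) (gen k .u) := by
    have : gen k .u * gen k .g = gen k .g * gen k .u := by
      simpa [gen] using rel_eq k Rel.u_g
    exact this.symm
  have xu : Commute (gen k .x) (gen k .u) := by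
    have : gen k .u * gen k .x = gen k .x * gen k .u := by
      simpa [gen] using rel_eq k Rel.u_x
    exact this.symm
  exact ((Commute.refl _).mul_left xu).add_left
    ((Commute.ofNat_left 2 _).mul_left ((Commute.one_left _).add_left gu))

theorem q_commute_x : Commute (q k) (gen k .x) := by
  have gx : Commute (gen k .g) (gen k .x) := by
    have : gen k .g * gen k .x = gen k .x * gen k .g := by
      simpa [gen] using rel_eq k Rel.g_x
    exact this
  have ux : Commute (gen k .u) (gen k .x) := by
    have : gen k .u * gen k .x = gen k .x * gen k .u := by
      simpa [gen] using rel_eq k Rel.u_x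
    exact this
  exact (ux.mul_left (Commute.refl _)).add_left
    ((Commute.ofNat_left 2 _).mul_left ((Commute.one_left _).add_left gx))

theorem q_commute_g : Commute (q k) (gen k .g) := by
  have xg : Commute (gen k .x) (gen k .g) := by
    have : gen k .g * gen k .x = gen k .x * gen k .g := by
      simpa [gen] using rel_eq k Rel.g_x
    exact this.symm
  have ug : Commute (gen k .u) (gen k .g) := by
    have : gen k .u * gen k .g = gen k .g * gen k .u := by
      simpa [gen] using rel_eq k Rel.u_g
    exact this
  exact (ug.mul_left xg).add_left
    ((Commute.ofNat_left 2 _).mul_left ((Commute.one_left _).add_left (Commute.refl _)))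

theorem q_commute_zeta : Commute (q k) (gen k .zeta) := by
  have zg : gen k .zeta * gen k .g = gen k .g * gen k .zeta := by
    simpa [gen] using rel_eq k Rel.zeta_g
  have uz : gen k .u * gen k .zeta = gen k .zeta * gen k .u + gen k .u := by
    simpa [gen] using rel_eq k Rel.u_zeta
  have zx : gen k .zeta * gen k .x = gen k .x * gen k .zeta + gen k .x := by
    simpa [gen] using rel_eq k Rel.zeta_x
  have hux : Commute (gen k .u * gen k .x) (gen k .zeta) := by
    have h1 : gen k .x * gen k .zeta = gen k .zeta * gen k .x - gen k .x := by
      rw [zx]; abel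
    change gen k .u * gen k .x * gen k .zeta = gen k .zeta * (gen k .u * gen k .x)
    rw [mul_assoc, h1, mul_sub, ← mul_assoc, uz]
    noncomm_ring
  have hg : Commute (gen k .g) (gen k .zeta) := zg.symm
  exact hux.add_left ((Commute.ofNat_left 2 _).mul_left ((Commute.one_left _).add_left hg))

theorem q_isLocallyAdNilpotent : IsLocallyAdNilpotent (q k) := by
  have gy : gen k .g * gen k .y = gen k .y * gen k .g + gen k .x * gen k .g := by
    simpa [gen] using rel_eq k Rel.g_y
  have yx : gen k .y * gen k .x = gen k .x * gen k .y - (1 / 2 : k) • gen k .x ^ 2 := by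
    simpa [gen] using rel_eq k Rel.y_x
  have uy : gen k .u * gen k .y = gen k .y * gen k .u + (1 - gen k .g) := by
    simpa [gen] using rel_eq k Rel.u_y
  have vu : gen k .v * gen k .u = gen k .u * gen k .v - (1 / 2 : k) • gen k .u ^ 2 := by
    simpa [gen] using rel_eq k Rel.v_u
  have vx : gen k .v * gen k .x
      = gen k .x * gen k .v + (1 - gen k .g) + gen k .x * gen k .u := by
    simpa [gen] using rel_eq k Rel.v_x
  have vg : gen k .v * gen k .g = gen k .g * gen k .v + gen k .g * gen k .u := by
    simpa [gen] using rel_eq k Rel.v_g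
  have cu := q_commute_u k
  have cx := q_commute_x k
  have cg := q_commute_g k
  have c1 : Commute (q k) 1 := Commute.one_right _
  have c2 : Commute (q k) 2 := Commute.ofNat_right _ 2
  apply isLocallyAdNilpotent_of_generators (mk k) (mk_surjective k)
  intro i
  change ∃ n : ℕ, (fun b => q k * b - b * q k)^[n] (gen k i) = 0
  cases i with
  | u => exact ⟨1, by simp [cu.eq]⟩
  | g => exact ⟨1, by simp [cg.eq]⟩
  | ginv => exact ⟨1, by simp [(commute_ginv k cg).eq]⟩
  | x => exact ⟨1, by simp [cx.eq]⟩
  | zeta => exact ⟨1, by simp [(q_commute_zeta k).eq]⟩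
  | y =>
    have h : q k * gen k .y - gen k .y * q k
        = (1 - gen k .g) * gen k .x + (1 / 2 : k) • (gen k .u * gen k .x ^ 2)
          + 2 * (gen k .x * gen k .g) := by
      have xy : gen k .x * gen k .y
          = gen k .y * gen k .x + (1 / 2 : k) • gen k .x ^ 2 := by
        rw [yx]; abel
      have e : q k * gen k .y = gen k .u * (gen k .x * gen k .y) + 2 * gen k .y
          + 2 * (gen k .g * gen k .y) := by
        rw [q]; noncomm_ring
      rw [e, xy, gy, mul_add (gen k .u), ← mul_assoc (gen k .u), uy, mul_smul_comm, q]
      noncomm_ring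
    exact ⟨2, iterate_two_ad h (((((c1.sub_right cg).mul_right cx)).add_right
      ((cu.mul_right (cx.pow_right 2)).smul_right _)).add_right
      (c2.mul_right (cx.mul_right cg)))⟩
  | v =>
    have h : q k * gen k .v - gen k .v * q k
        = (1 / 2 : k) • (gen k .u ^ 2 * gen k .x) - gen k .u * (1 - gen k .g)
          - gen k .u * gen k .x * gen k .u - 2 * (gen k .g * gen k .u) := by
      have e : gen k .v * q k = gen k .v * gen k .u * gen k .x + 2 * gen k .v
          + 2 * (gen k .v * gen k .g) := by
        rw [q]; noncomm_ring
      rw [e, vu, vg, sub_mul, mul_assoc (gen k .u) (gen k .v), vx, smul_mul_assoc, q]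
      noncomm_ring
    exact ⟨2, iterate_two_ad h (((((cu.pow_right 2).mul_right cx).smul_right _).sub_right
      (cu.mul_right (c1.sub_right cg))).sub_right ((cu.mul_right cx).mul_right cu)
      |>.sub_right (c2.mul_right (cg.mul_right cu)))⟩

/-- The multiplicative set generated by `x` and `q`. -/
noncomputable abbrev denominators : Submonoid (JordanDouble k) := Submonoid.closure {gen k .x, q k}

noncomputable instance : OreLocalization.OreSet (denominators k) :=
  (nonempty_oreSet_closure _ (by
    rintro s (rfl | rfl)
    · exact x_isLocallyAdNilpotent k
    · exact q_isLocallyAdNilpotent k)).some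

end Elements

end JordanDouble

/-- The Ore localization `𝒟′` of `𝒟` at the multiplicative set generated by `x` and `q`. -/
noncomputable abbrev JordanDoubleLoc (k : Type*) [Field k] : Type _ :=
  OreLocalization (JordanDouble.denominators k) (JordanDouble k)

namespace JordanDoubleLoc

section Elements

variable (k : Type*) [Field k]

/-- The canonical map `𝒟 → 𝒟′`. -/
noncomputable def ofD : JordanDouble k →+* JordanDoubleLoc k := OreLocalization.numeratorRingHom

/-- The inverse of `q` in `𝒟′`. -/
noncomputable def qInv : JordanDoubleLoc k :=
  OreLocalization.oreDiv 1
    (⟨JordanDouble.q k, Submonoid.subset_closure (by simp)⟩ : JordanDouble.denominators k)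

/-- `z = q² g⁻¹` in `𝒟′`. -/
noncomputable def z : JordanDoubleLoc k := ofD k (JordanDouble.z k)

/-- The inverse `g q⁻²` of `z` in `𝒟′`. -/
noncomputable def zInv : JordanDoubleLoc k := ofD k (JordanDouble.gen k .g) * qInv k ^ 2

/-- `z' = q⁻¹ [x v + u y + (-½ u x + g - 1) ζ - 2 (1 + g)]` in `𝒟′`. -/
noncomputable def zPrime : JordanDoubleLoc k := qInv k * ofD k (JordanDouble.s k)

end Elements

end JordanDoubleLoc

/-! ## Weyl algebras and their localizations -/

namespace WeylAlgebra

section Presentation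

variable (n : ℕ) (R : Type*) [CommRing R]

/-- The free generator `q_i`. -/
def freeQ (i : Fin n) : FreeAlgebra R (Fin n ⊕ Fin n) := FreeAlgebra.ι R (Sum.inl i)

/-- The free generator `p_i`. -/
def freeP (i : Fin n) : FreeAlgebra R (Fin n ⊕ Fin n) := FreeAlgebra.ι R (Sum.inr i)

/-- The defining relations of the `n`-th Weyl algebra: `p_i q_i - q_i p_i = 1`, and all other
pairs of generators commute. -/
inductive Rel : FreeAlgebra R (Fin n ⊕ Fin n) → FreeAlgebra R (Fin n ⊕ Fin n) → Prop
  | q_q (i j : Fin n) : Rel (freeQ n R i * freeQ n R j) (freeQ n R j * freeQ n R i)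
  | p_p (i j : Fin n) : Rel (freeP n R i * freeP n R j) (freeP n R j * freeP n R i)
  | p_q_self (i : Fin n) : Rel (freeP n R i * freeQ n R i) (freeQ n R i * freeP n R i + 1)
  | p_q (i j : Fin n) (h : i ≠ j) :
      Rel (freeP n R i * freeQ n R j) (freeQ n R j * freeP n R i)

end Presentation

end WeylAlgebra

/-- The Weyl algebra `A_n(R)`, generated over `R` by `q_1, …, q_n, p_1, …, p_n`. -/
def WeylAlgebra (n : ℕ) (R : Type*) [CommRing R] : Type _ := RingQuot (WeylAlgebra.Rel n R)

namespace WeylAlgebra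

section Elements

variable (n : ℕ) (R : Type*) [CommRing R]

noncomputable instance : Ring (WeylAlgebra n R) :=
  inferInstanceAs (Ring (RingQuot (Rel n R)))

noncomputable instance {A : Type*} [CommSemiring A] [Algebra A R] :
    Algebra A (WeylAlgebra n R) :=
  inferInstanceAs (Algebra A (RingQuot (Rel n R)))

/-- The quotient map from the free algebra to `A_n(R)`. -/
noncomputable def mk : FreeAlgebra R (Fin n ⊕ Fin n) →ₐ[R] WeylAlgebra n R :=
  RingQuot.mkAlgHom R (Rel n R)

theorem mk_surjective : Function.Surjective (mk n R) :=
  RingQuot.mkAlgHom_surjective R (Rel n R)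

theorem rel_eq {a b : FreeAlgebra R (Fin n ⊕ Fin n)} (h : Rel n R a b) :
    mk n R a = mk n R b :=
  RingQuot.mkAlgHom_rel R h

/-- The generator `q_i` of `A_n(R)`. -/
noncomputable def q (i : Fin n) : WeylAlgebra n R := mk n R (freeQ n R i)

/-- The generator `p_i` of `A_n(R)`. -/
noncomputable def p (i : Fin n) : WeylAlgebra n R := mk n R (freeP n R i)

theorem q_isLocallyAdNilpotent (i : Fin n) : IsLocallyAdNilpotent (q n R i) := by
  apply isLocallyAdNilpotent_of_generators (mk n R) (mk_surjective n R)
  rintro (j | j)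
  · change ∃ m : ℕ, (fun b => q n R i * b - b * q n R i)^[m] (q n R j) = 0
    have h : q n R i * q n R j = q n R j * q n R i := by
      simpa [q] using rel_eq n R (Rel.q_q i j)
    exact ⟨1, by simp [h]⟩
  · change ∃ m : ℕ, (fun b => q n R i * b - b * q n R i)^[m] (p n R j) = 0
    by_cases hij : j = i
    · subst hij
      have h : p n R j * q n R j = q n R j * p n R j + 1 := by
        simpa [p, q] using rel_eq n R (Rel.p_q_self j)
      have h' : q n R j * p n R j - p n R j * q n R j = -1 := by rw [h]; abel
      exact ⟨2, iterate_two_ad h' (Commute.one_right _).neg_right⟩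
    · have h : p n R j * q n R i = q n R i * p n R j := by
        simpa [p, q] using rel_eq n R (Rel.p_q j i hij)
      exact ⟨1, by simp [h]⟩

/-- The multiplicative set generated by `q_1, …, q_n`. -/
noncomputable abbrev denominators : Submonoid (WeylAlgebra n R) := Submonoid.closure (Set.range (q n R))

noncomputable instance : OreLocalization.OreSet (denominators n R) :=
  (nonempty_oreSet_closure _ (by
    rintro s ⟨i, rfl⟩
    exact q_isLocallyAdNilpotent n R i)).some

end Elements

end WeylAlgebra

/-- The localized Weyl algebra `A'_n(R)`, the Ore localization of `A_n(R)` at the multiplicative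
set generated by `q_1, …, q_n`. -/
noncomputable abbrev WeylAlgebraLoc (n : ℕ) (R : Type*) [CommRing R] : Type _ :=
  OreLocalization (WeylAlgebra.denominators n R) (WeylAlgebra n R)

/-!
The automorphisms `σ_c : y ↦ y + c x, v ↦ v - c u` of `𝒟` form a one-parameter group, and
`b a = σ_c(a) b` for all `a`, with `c = 1` for `b = g` and `c = 1/2` for both `b = q` and `b = s`.
Hence `z = q² g⁻¹` and `z' = q⁻¹ s` are central in `𝒟′`.

With `ζ` and `θ = -2 x⁻¹ y - ζ` acting as Euler operators on the commuting units `x` and `q`, the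
algebra `𝒟′` is universal among those carrying such a pair together with a central unit `z` and a
central element `z'`. The algebra `A'_2(k[z^{±1}, z'])` has the same universal property, with Euler
operators `q_i p_i`, so the two are isomorphic.

The center of `A'_n(R)` is `R`, because a central element cannot involve `p_i`, by looking at the
eigenvalues of `a ↦ (a q_i - q_i a) p_i`, nor `q_i`, by looking at those of the commutator with
`q_i p_i`.
-/

section OreLocalization

open OreLocalization

variable {k R T : Type*} [CommRing k] [Ring R] [Algebra k R] [Ring T] [Algebra k T]
  (S : Submonoid R) [OreSet S]

variable (k) in
/-- The canonical map to an Ore localization, as a homomorphism of algebras. -/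
def numeratorAlgHom : R →ₐ[k] OreLocalization S R :=
  { (numeratorRingHom : R →+* OreLocalization S R) with commutes' := fun _ => rfl }

variable {S}

theorem isUnit_numeratorAlgHom {s : R} (hs : s ∈ S) : IsUnit (numeratorAlgHom k S s) :=
  numerator_isUnit (⟨s, hs⟩ : S)

variable (k) in
theorem exists_numeratorAlgHom_mul_eq (m : OreLocalization S R) :
    ∃ s ∈ S, ∃ a : R, numeratorAlgHom k S s * m = numeratorAlgHom k S a := by
  induction m using OreLocalization.ind with
  | _ a s => exact ⟨s, s.2, a, OreLocalization.mul_cancel⟩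

theorem algHom_ext_numeratorAlgHom {f g : OreLocalization S R →ₐ[k] T}
    (h : f.comp (numeratorAlgHom k S) = g.comp (numeratorAlgHom k S)) : f = g := by
  ext m
  obtain ⟨s, hs, a, ha⟩ := exists_numeratorAlgHom_mul_eq k m
  have agree (b : R) : f (numeratorAlgHom k S b) = g (numeratorAlgHom k S b) :=
    DFunLike.congr_fun h b
  refine ((isUnit_numeratorAlgHom (k := k) hs).map f).mul_left_cancel ?_
  rw [← map_mul, ha, agree, agree, ← map_mul, ha]

/-- The universal property of an Ore localization, for homomorphisms of algebras. -/
noncomputable def universalAlgHom (f : R →ₐ[k] T) (hf : ∀ s ∈ S, IsUnit (f s)) :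
    OreLocalization S R →ₐ[k] T :=
  { universalHom (f : R →+* T)
      (IsUnit.liftRight ((f : R →* T).comp S.subtype) fun s => hf s s.2) (fun _ => rfl) with
    commutes' := fun r => (universalHom_commutes (f : R →+* T) _ _).trans (f.commutes r) }

theorem universalAlgHom_numeratorAlgHom (f : R →ₐ[k] T) (hf : ∀ s ∈ S, IsUnit (f s)) (a : R) :
    universalAlgHom f hf (numeratorAlgHom k S a) = f a :=
  universalHom_commutes (f : R →+* T) _ _

theorem commute_of_commute_numeratorAlgHom {c : OreLocalization S R}
    (h : ∀ a, Commute c (numeratorAlgHom k S a)) (m : OreLocalization S R) : Commute c m := by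
  obtain ⟨s, hs, a, ha⟩ := exists_numeratorAlgHom_mul_eq k m
  refine (isUnit_numeratorAlgHom (k := k) hs).mul_left_cancel ?_
  rw [← mul_assoc, ← mul_assoc, ← (h s).eq, mul_assoc, ha, (h a).eq]

end OreLocalization

theorem isUnit_map_of_mem_closure {M N F : Type*} [Monoid M] [Monoid N] [FunLike F M N]
    [MonoidHomClass F M N] (f : F) {s : Set M} (h : ∀ a ∈ s, IsUnit (f a)) {a : M}
    (ha : a ∈ Submonoid.closure s) : IsUnit (f a) :=
  (Submonoid.closure_le (S := (IsUnit.submonoid N).comap f)).mpr h ha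

theorem mul_mul_of_mul_eq {A : Type*} [Semigroup A] {a b c : A} (h : a * b = c) (d : A) :
    a * (b * d) = c * d := by
  rw [← h, mul_assoc]

namespace JordanDouble

section UniversalProperty

variable {k : Type*} [Field k] {A : Type*} [Ring A] [Algebra k A]

/-- The universal property of the presentation of `𝒟`. -/
noncomputable def lift (f : Gen → A)
    (hf : ∀ ⦃a b⦄, Rel k a b → FreeAlgebra.lift k f a = FreeAlgebra.lift k f b) :
    JordanDouble k →ₐ[k] A :=
  RingQuot.liftAlgHom k ⟨FreeAlgebra.lift k f, hf⟩

theorem lift_gen (f : Gen → A)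
    (hf : ∀ ⦃a b⦄, Rel k a b → FreeAlgebra.lift k f a = FreeAlgebra.lift k f b) (i : Gen) :
    lift f hf (gen k i) = f i :=
  (RingQuot.liftAlgHom_mkAlgHom_apply k (FreeAlgebra.lift k f) hf _).trans
    (FreeAlgebra.lift_ι_apply f i)

theorem gen_induction {P : JordanDouble k → Prop} (algebraMap : ∀ c, P (algebraMap k _ c))
    (gen : ∀ i, P (gen k i)) (mul : ∀ a b, P a → P b → P (a * b))
    (add : ∀ a b, P a → P b → P (a + b)) (a : JordanDouble k) : P a := by
  obtain ⟨f, rfl⟩ := mk_surjective k a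
  induction f using FreeAlgebra.induction with
  | grade0 c => rw [AlgHom.commutes]; exact algebraMap c
  | grade1 i => exact gen i
  | mul a b iha ihb => rw [map_mul]; exact mul _ _ iha ihb
  | add a b iha ihb => rw [map_add]; exact add _ _ iha ihb

theorem semiconjBy_of_gen {φ ψ : JordanDouble k →ₐ[k] A} {c : A}
    (h : ∀ i, SemiconjBy c (φ (gen k i)) (ψ (gen k i))) (a : JordanDouble k) :
    SemiconjBy c (φ a) (ψ a) := by
  induction a using gen_induction with
  | algebraMap r =>
    rw [AlgHom.commutes, AlgHom.commutes]
    exact Algebra.commute_algebraMap_right r c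
  | gen i => exact h i
  | mul a b iha ihb => rw [map_mul, map_mul]; exact iha.mul_right ihb
  | add a b iha ihb => rw [map_add, map_add]; exact iha.add_right ihb

theorem algHom_ext {φ ψ : JordanDouble k →ₐ[k] A} (h : ∀ i, φ (gen k i) = ψ (gen k i)) :
    φ = ψ :=
  AlgHom.ext fun a => by
    simpa [SemiconjBy] using semiconjBy_of_gen (c := (1 : A)) (fun i => by simp [h]) a

end UniversalProperty

section Relations

variable (k : Type*) [Field k]

theorem g_mul_ginv : gen k .g * gen k .ginv = 1 := by simpa [gen] using rel_eq k Rel.g_ginv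

theorem ginv_mul_g : gen k .ginv * gen k .g = 1 := by simpa [gen] using rel_eq k Rel.ginv_g

theorem zeta_mul_g : gen k .zeta * gen k .g = gen k .g * gen k .zeta := by
  simpa [gen] using rel_eq k Rel.zeta_g

theorem g_mul_x : gen k .g * gen k .x = gen k .x * gen k .g := by
  simpa [gen] using rel_eq k Rel.g_x

theorem g_mul_y : gen k .g * gen k .y = gen k .y * gen k .g + gen k .x * gen k .g := by
  simpa [gen] using rel_eq k Rel.g_y

theorem zeta_mul_y : gen k .zeta * gen k .y = gen k .y * gen k .zeta + gen k .y := by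
  simpa [gen] using rel_eq k Rel.zeta_y

theorem zeta_mul_x : gen k .zeta * gen k .x = gen k .x * gen k .zeta + gen k .x := by
  simpa [gen] using rel_eq k Rel.zeta_x

theorem g_mul_u : gen k .g * gen k .u = gen k .u * gen k .g := by
  simpa [gen] using (rel_eq k Rel.u_g).symm

theorem v_mul_g : gen k .v * gen k .g = gen k .g * gen k .v + gen k .u * gen k .g := by
  rw [← g_mul_u]
  simpa [gen] using rel_eq k Rel.v_g

theorem zeta_mul_v : gen k .zeta * gen k .v = gen k .v * gen k .zeta - gen k .v :=
  eq_sub_of_add_eq (by simpa [gen] using (rel_eq k Rel.v_zeta).symm)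

theorem zeta_mul_u : gen k .zeta * gen k .u = gen k .u * gen k .zeta - gen k .u :=
  eq_sub_of_add_eq (by simpa [gen] using (rel_eq k Rel.u_zeta).symm)

theorem y_mul_x :
    gen k .y * gen k .x = gen k .x * gen k .y - (1 / 2 : k) • (gen k .x * gen k .x) := by
  simpa [gen, pow_two] using rel_eq k Rel.y_x

theorem v_mul_u :
    gen k .v * gen k .u = gen k .u * gen k .v - (1 / 2 : k) • (gen k .u * gen k .u) := by
  simpa [gen, pow_two] using rel_eq k Rel.v_u

theorem u_mul_x : gen k .u * gen k .x = gen k .x * gen k .u := by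
  simpa [gen] using rel_eq k Rel.u_x

theorem v_mul_x : gen k .v * gen k .x
    = gen k .x * gen k .v + (1 - gen k .g) + gen k .x * gen k .u := by
  simpa [gen] using rel_eq k Rel.v_x

theorem u_mul_y : gen k .u * gen k .y = gen k .y * gen k .u + (1 - gen k .g) := by
  simpa [gen] using rel_eq k Rel.u_y

theorem v_mul_y : gen k .v * gen k .y
    = gen k .y * gen k .v - gen k .g * gen k .zeta + gen k .y * gen k .u := by
  simpa [gen] using rel_eq k Rel.v_y

end Relations

section Twist

variable (k : Type*) [Field k] [CharZero k]

/-- The images of the generators under the automorphism `twist k c`. -/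
noncomputable def twistGen (c : k) : Gen → JordanDouble k
  | .y => gen k .y + c • gen k .x
  | .v => gen k .v - c • gen k .u
  | i => gen k i

theorem lift_twistGen_eq_of_rel (c : k) ⦃a b : FreeAlgebra k Gen⦄ (h : Rel k a b) :
    FreeAlgebra.lift k (twistGen k c) a = FreeAlgebra.lift k (twistGen k c) b := by
  cases h
  all_goals
    simp only [free, map_mul, map_add, map_sub, map_one, map_smul, FreeAlgebra.lift_ι_apply,
      twistGen, pow_two, g_mul_ginv, ginv_mul_g, mul_add, add_mul, sub_mul, mul_sub,
      smul_mul_assoc, mul_smul_comm, smul_add, smul_sub, zeta_mul_g, g_mul_x, g_mul_y, zeta_mul_y,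
      zeta_mul_x, g_mul_u, v_mul_g, zeta_mul_v, zeta_mul_u, y_mul_x, v_mul_u, u_mul_x, v_mul_x,
      u_mul_y, v_mul_y]
  all_goals module

/-- The one-parameter group of automorphisms of `𝒟` given by `y ↦ y + c x`, `v ↦ v - c u` and the
identity on the other generators: `g` induces `twist k 1`, while `q` and `s` induce
`twist k (1 / 2)`. -/
noncomputable def twist (c : k) : JordanDouble k →ₐ[k] JordanDouble k :=
  lift (twistGen k c) (lift_twistGen_eq_of_rel k c)

theorem twist_gen (c : k) (i : Gen) : twist k c (gen k i) = twistGen k c i :=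
  lift_gen _ _ i

theorem twist_twist (c d : k) (a : JordanDouble k) :
    twist k c (twist k d a) = twist k (c + d) a := by
  refine DFunLike.congr_fun (algHom_ext (φ := (twist k c).comp (twist k d)) fun i => ?_) a
  cases i
  case y => simp [twist_gen, twistGen, add_smul, add_assoc]
  case v => simp [twist_gen, twistGen, add_smul, sub_sub]
  all_goals simp [twist_gen, twistGen]

theorem twist_zero (a : JordanDouble k) : twist k 0 a = a := by
  refine DFunLike.congr_fun (algHom_ext (ψ := AlgHom.id k _) fun i => ?_) a
  cases i <;> simp [twist_gen, twistGen]

theorem semiconjBy_twist_of_gen {c : k} {b : JordanDouble k}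
    (h : ∀ i, SemiconjBy b (gen k i) (twistGen k c i)) (a : JordanDouble k) :
    SemiconjBy b a (twist k c a) :=
  semiconjBy_of_gen (φ := AlgHom.id k _) (fun i => by simpa [twist_gen] using h i) a

theorem semiconjBy_g_twist (a : JordanDouble k) : SemiconjBy (gen k .g) a (twist k 1 a) := by
  refine semiconjBy_twist_of_gen k (fun i => ?_) a
  cases i with
  | u => exact g_mul_u k
  | g => exact Commute.refl _
  | ginv => exact (g_mul_ginv k).trans (ginv_mul_g k).symm
  | x => exact g_mul_x k
  | zeta => exact (zeta_mul_g k).symm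
  | y => rw [SemiconjBy, twistGen, one_smul, add_mul, g_mul_y]
  | v => rw [SemiconjBy, twistGen, one_smul, sub_mul, v_mul_g, add_sub_cancel_right]

theorem semiconjBy_ginv_twist (a : JordanDouble k) :
    SemiconjBy (gen k .ginv) a (twist k (-1) a) := by
  let gUnit : (JordanDouble k)ˣ := ⟨gen k .g, gen k .ginv, g_mul_ginv k, ginv_mul_g k⟩
  have h : SemiconjBy (gUnit : JordanDouble k) (twist k (-1) a) a := by
    simpa [twist_twist, twist_zero] using semiconjBy_g_twist k (twist k (-1) a)
  exact h.units_inv_symm_left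

theorem semiconjBy_q_twist (a : JordanDouble k) : SemiconjBy (q k) a (twist k (1 / 2) a) := by
  have e {a b c : JordanDouble k} := mul_mul_of_mul_eq (a := a) (b := b) (c := c)
  have two_eq : (2 : JordanDouble k) = 1 + 1 := one_add_one_eq_two.symm
  refine semiconjBy_twist_of_gen k (fun i => ?_) a
  cases i with
  | u => exact q_commute_u k
  | g => exact q_commute_g k
  | ginv => exact commute_ginv k (q_commute_g k)
  | x => exact q_commute_x k
  | zeta => exact q_commute_zeta k
  | y | v =>
    unfold SemiconjBy q
    simp only [twistGen, mul_add, add_mul, sub_mul, mul_sub, smul_mul_assoc, mul_smul_comm,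
      mul_assoc, one_mul, mul_one, two_eq, g_mul_u, g_mul_y, v_mul_g, v_mul_u, e (y_mul_x k),
      u_mul_y, u_mul_x, e (u_mul_x k), e (v_mul_x k)]
    module

theorem semiconjBy_s_twist (a : JordanDouble k) : SemiconjBy (s k) a (twist k (1 / 2) a) := by
  have e {a b c : JordanDouble k} := mul_mul_of_mul_eq (a := a) (b := b) (c := c)
  have two_eq : (2 : JordanDouble k) = 1 + 1 := one_add_one_eq_two.symm
  have commute_g : Commute (s k) (gen k .g) := by
    unfold Commute SemiconjBy s
    simp only [mul_add, add_mul, sub_mul, mul_sub, neg_mul, mul_neg, smul_mul_assoc, mul_smul_comm,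
      mul_assoc, one_mul, mul_one, two_eq, zeta_mul_g, e (g_mul_x k), g_mul_y, e (g_mul_u k),
      v_mul_g, u_mul_x, e (u_mul_x k)]
    module
  refine semiconjBy_twist_of_gen k (fun i => ?_) a
  cases i
  case g => exact commute_g
  case ginv => exact commute_ginv k commute_g
  all_goals
    unfold SemiconjBy s
    simp only [twistGen, mul_add, add_mul, sub_mul, mul_sub, neg_mul, mul_neg, smul_mul_assoc,
      mul_smul_comm, smul_add, smul_sub, mul_assoc, one_mul, mul_one, two_eq, zeta_mul_g,
      e (zeta_mul_g k), g_mul_x, e (g_mul_x k), g_mul_y, e (g_mul_y k), zeta_mul_y,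
      e (zeta_mul_y k), zeta_mul_x, e (zeta_mul_x k), g_mul_u, e (g_mul_u k), v_mul_g,
      e (v_mul_g k), zeta_mul_v, zeta_mul_u, e (zeta_mul_u k), e (y_mul_x k), v_mul_u,
      e (v_mul_u k), u_mul_x, e (u_mul_x k), v_mul_x, e (v_mul_x k), u_mul_y, e (u_mul_y k),
      v_mul_y, e (v_mul_y k)]
    module

theorem isNormalElement_q : IsNormalElement (q k) := by
  ext c
  constructor
  · rintro ⟨a, rfl⟩
    refine ⟨twist k (-(1 / 2)) a, ?_⟩
    simpa [twist_twist, twist_zero] using (semiconjBy_q_twist k (twist k (-(1 / 2)) a)).eq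
  · rintro ⟨a, rfl⟩
    exact ⟨twist k (1 / 2) a, (semiconjBy_q_twist k a).eq.symm⟩

theorem commute_z (a : JordanDouble k) : Commute (z k) a := by
  have h : SemiconjBy (z k) a (twist k (1 / 2) (twist k (1 / 2) (twist k (-1) a))) := by
    rw [z, pow_two]
    exact ((semiconjBy_q_twist k _).mul_left (semiconjBy_q_twist k _)).mul_left
      (semiconjBy_ginv_twist k a)
  have htwist : (1 / 2 : k) + 1 / 2 + -1 = 0 := by norm_num
  rwa [twist_twist, twist_twist, htwist, twist_zero] at h

theorem commute_s_q : Commute (s k) (q k) := by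
  have htwist : twist k (1 / 2) (q k) = q k := by
    simp only [q, map_add, map_mul, map_ofNat, map_one, twist_gen, twistGen]
  have h := semiconjBy_s_twist k (q k)
  rwa [htwist] at h

end Twist

end JordanDouble

theorem map_units_inv_eq {M N F : Type*} [Monoid M] [Monoid N] [FunLike F M N]
    [MonoidHomClass F M N] (f : F) {u : Mˣ} {v : Nˣ} (h : f u = v) : f ↑u⁻¹ = ↑v⁻¹ := by
  obtain rfl : Units.map (f : M →* N) u = v := Units.ext h
  rfl

/-- The data generating the localization `𝒟′` in the most symmetric form: `zeta` and `theta` act on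
the commuting units `x` and `q` as the Euler operators `x ∂/∂x` and `q ∂/∂q`, and the unit `z` and
the element `zPrime` are central. -/
structure EulerSystem (A : Type*) [Ring A] where
  x : Aˣ
  q : Aˣ
  z : Aˣ
  zPrime : A
  zeta : A
  theta : A
  commute_x_q : Commute (x : A) q
  commute_z : ∀ a, Commute (z : A) a
  commute_zPrime : ∀ a, Commute zPrime a
  zeta_mul_x : zeta * x = x * zeta + x
  commute_zeta_q : Commute zeta q
  commute_theta_x : Commute theta x
  theta_mul_q : theta * q = q * theta + q
  commute_theta_zeta : Commute theta zeta

namespace EulerSystem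

section Ring

variable {A : Type*} [Ring A] (E : EulerSystem A)

/-- The unit `z⁻¹ q²`, the image of `g ∈ 𝒟`. -/
def g : Aˣ := E.z⁻¹ * E.q ^ 2

theorem commute_g {a : A} (h : Commute a E.q) : Commute a E.g := by
  simpa only [g, Units.val_mul, pow_two] using
    (E.commute_z a).symm.units_inv_right.mul_right (h.mul_right h)

theorem theta_mul_g : E.theta * E.g = E.g * E.theta + 2 * E.g := by
  have z_inv_mul (a : A) : a * ↑E.z⁻¹ = ↑E.z⁻¹ * a := (E.commute_z a).symm.units_inv_right.eq
  simp only [g, Units.val_mul, pow_two]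
  rw [← mul_assoc, z_inv_mul, mul_assoc, ← mul_assoc E.theta, E.theta_mul_q, add_mul, mul_assoc,
    E.theta_mul_q]
  simp only [two_mul, mul_add, mul_assoc, add_assoc]

theorem zeta_mul_x_inv : E.zeta * ↑E.x⁻¹ = ↑E.x⁻¹ * E.zeta - ↑E.x⁻¹ := by
  rw [eq_sub_iff_add_eq, ← Units.mul_right_inj E.x, mul_add, Units.mul_inv_cancel_left,
    ← mul_assoc, eq_sub_of_add_eq E.zeta_mul_x.symm]
  simp [sub_mul, mul_assoc]

end Ring

section Homomorphism

open JordanDouble (Gen Rel gen free)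

variable (k : Type*) [Field k] {A : Type*} [Ring A] [Algebra k A] (E : EulerSystem A)

/-- The images of the generators of `𝒟` defined by an Euler system. Those of `u`, `y` and `v` solve
the equations `q = u x + 2 (1 + g)`, `θ = -2 x⁻¹ y - ζ` and `s = q z'`. -/
def genImage : Gen → A
  | .x => E.x
  | .g => E.g
  | .ginv => ↑E.g⁻¹
  | .zeta => E.zeta
  | .u => ↑E.x⁻¹ * (E.q - 2 - 2 * E.g)
  | .y => -((1 / 2 : k) • (E.x * (E.theta + E.zeta)))
  | .v => ↑E.x⁻¹ * (E.q * E.zPrime + 2 + 2 * E.g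
      + ((1 / 2 : k) • (E.q : A) - 1 - E.g) * (E.theta + E.zeta)
      + ((1 / 2 : k) • (E.q : A) - 2 * E.g) * E.zeta)

variable [CharZero k]

theorem lift_genImage_eq_of_rel ⦃a b : FreeAlgebra k Gen⦄ (h : Rel k a b) :
    FreeAlgebra.lift k (E.genImage k) a = FreeAlgebra.lift k (E.genImage k) b := by
  have e {a b c : A} (h : a * b = c) (d : A) : a * (b * d) = c * d := mul_mul_of_mul_eq h d
  have two_eq : (2 : A) = 1 + 1 := one_add_one_eq_two.symm
  have x_inv {a : A} (h : Commute a E.x) : a * ↑E.x⁻¹ = ↑E.x⁻¹ * a := h.units_inv_right.eq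
  have qx := E.commute_x_q.symm
  have gx := (E.commute_g E.commute_x_q).symm
  have qg := E.commute_g (Commute.refl _)
  have ζg := E.commute_g E.commute_zeta_q
  have zPrime_mul (a : A) : E.zPrime * a = a * E.zPrime := (E.commute_zPrime a).eq
  cases h
  all_goals
    simp only [free, map_mul, map_add, map_sub, map_one, map_smul, FreeAlgebra.lift_ι_apply,
      genImage, Units.mul_inv, Units.inv_mul, ζg.eq, E.zeta_mul_x, gx.eq, pow_two]
  all_goals
    simp only [mul_add, add_mul, sub_mul, mul_sub, neg_mul, mul_neg, smul_mul_assoc, mul_smul_comm,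
      smul_add, smul_sub, smul_neg, mul_assoc, one_mul, mul_one, two_eq, Units.mul_inv_cancel_left,
      Units.inv_mul_cancel_left, Units.mul_inv, Units.inv_mul, zPrime_mul, x_inv qx, e (x_inv qx),
      x_inv gx, e (x_inv gx), x_inv E.commute_theta_x, e (x_inv E.commute_theta_x),
      E.zeta_mul_x_inv, e E.zeta_mul_x_inv, qx.eq, e qx.eq, gx.eq, e gx.eq, qg.eq, e qg.eq,
      E.zeta_mul_x, e E.zeta_mul_x, E.commute_zeta_q.eq, e E.commute_zeta_q.eq, ζg.eq, e ζg.eq,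
      E.commute_theta_x.eq, e E.commute_theta_x.eq, E.theta_mul_q, e E.theta_mul_q, E.theta_mul_g,
      e E.theta_mul_g, E.commute_theta_zeta.eq]
  all_goals module

/-- The homomorphism from `𝒟` defined by an Euler system. -/
noncomputable def hom : JordanDouble k →ₐ[k] A :=
  JordanDouble.lift (E.genImage k) (E.lift_genImage_eq_of_rel k)

theorem hom_gen (i : Gen) : E.hom k (gen k i) = E.genImage k i :=
  JordanDouble.lift_gen _ _ i

theorem hom_u_mul_x : E.hom k (gen k .u * gen k .x) = E.q - 2 - 2 * E.g := by
  have hx : Commute (E.q - 2 - 2 * E.g : A) E.x :=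
    (E.commute_x_q.symm.sub_left (Commute.ofNat_left 2 _)).sub_left
      ((Commute.ofNat_left 2 _).mul_left (E.commute_g E.commute_x_q).symm)
  rw [map_mul, hom_gen, hom_gen, genImage, genImage, mul_assoc, hx.eq, Units.inv_mul_cancel_left]

theorem hom_u_mul_y : E.hom k (gen k .u * gen k .y)
    = -((1 / 2 : k) • ((E.q - 2 - 2 * E.g) * (E.theta + E.zeta))) := by
  rw [map_mul, E.hom_gen k .y, genImage, mul_neg, mul_smul_comm, ← mul_assoc, ← hom_u_mul_x k,
    map_mul, E.hom_gen k .x, genImage]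

theorem hom_x_mul_v : E.hom k (gen k .x * gen k .v) = E.q * E.zPrime + 2 + 2 * E.g
    + ((1 / 2 : k) • (E.q : A) - 1 - E.g) * (E.theta + E.zeta)
    + ((1 / 2 : k) • (E.q : A) - 2 * E.g) * E.zeta := by
  rw [map_mul, hom_gen, hom_gen, genImage, genImage, Units.mul_inv_cancel_left]

theorem hom_q : E.hom k (JordanDouble.q k) = E.q := by
  rw [JordanDouble.q, map_add, hom_u_mul_x, map_mul, map_add, map_one, map_ofNat, hom_gen, genImage,
    mul_add, mul_one]
  abel

theorem hom_z : E.hom k (JordanDouble.z k) = E.z := by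
  have h : E.q ^ 2 * E.g⁻¹ = E.z := by simp [g]
  rw [JordanDouble.z, map_mul, map_pow, hom_q, hom_gen, genImage, ← h]
  rfl

theorem hom_s : E.hom k (JordanDouble.s k) = E.q * E.zPrime := by
  have two_eq : (2 : A) = 1 + 1 := one_add_one_eq_two.symm
  rw [JordanDouble.s, map_sub, map_add, map_add, hom_x_mul_v, hom_u_mul_y, map_mul, map_mul]
  simp only [map_add, map_sub, map_neg, map_smul, map_one, map_ofNat, hom_u_mul_x, hom_gen,
    genImage, mul_add, add_mul, sub_mul, neg_mul, smul_mul_assoc, smul_sub, smul_add, one_mul,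
    mul_one, two_eq]
  module

end Homomorphism

section IsHom

variable {k A B : Type*} [Field k] [Ring A] [Algebra k A] [Ring B] [Algebra k B]

/-- The algebra homomorphism `f` carries the Euler system `E` to the Euler system `F`. -/
structure IsHom (E : EulerSystem A) (F : EulerSystem B) (f : A →ₐ[k] B) : Prop where
  x : f E.x = F.x
  q : f E.q = F.q
  z : f E.z = F.z
  zPrime : f E.zPrime = F.zPrime
  zeta : f E.zeta = F.zeta
  theta : f E.theta = F.theta

theorem IsHom.id (E : EulerSystem A) : IsHom E E (AlgHom.id k A) :=
  ⟨rfl, rfl, rfl, rfl, rfl, rfl⟩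

variable {E : EulerSystem A} {F : EulerSystem B}

theorem IsHom.comp {C : Type*} [Ring C] [Algebra k C] {G : EulerSystem C} {f : A →ₐ[k] B}
    {h : B →ₐ[k] C} (hh : IsHom F G h) (hf : IsHom E F f) : IsHom E G (h.comp f) := by
  constructor <;>
    simp [hf.x, hf.q, hf.z, hf.zPrime, hf.zeta, hf.theta, hh.x, hh.q, hh.z, hh.zPrime, hh.zeta,
      hh.theta]

variable {f : A →ₐ[k] B}

theorem IsHom.g (hf : IsHom E F f) : f E.g = F.g := by
  simp only [EulerSystem.g, Units.val_mul, Units.val_pow_eq_pow_val, map_mul, map_pow, hf.q,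
    map_units_inv_eq f hf.z]

theorem IsHom.genImage (hf : IsHom E F f) (i : JordanDouble.Gen) :
    f (E.genImage k i) = F.genImage k i := by
  cases i <;>
    simp only [EulerSystem.genImage, map_add, map_sub, map_mul, map_neg, map_smul, map_one,
      map_ofNat, hf.x, hf.q, hf.g, hf.zPrime, hf.zeta, hf.theta, map_units_inv_eq f hf.x,
      map_units_inv_eq f hf.g]

theorem IsHom.comp_hom [CharZero k] (hf : IsHom E F f) : f.comp (E.hom k) = F.hom k :=
  JordanDouble.algHom_ext fun i => by simp [hom_gen, hf.genImage]

end IsHom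

end EulerSystem

/-- Elements satisfying the canonical commutation relations. -/
structure IsWeylSystem {ι A : Type*} [Ring A] (Q P : ι → A) : Prop where
  commute_q : ∀ i j, Commute (Q i) (Q j)
  commute_p : ∀ i j, Commute (P i) (P j)
  p_mul_q_self : ∀ i, P i * Q i = Q i * P i + 1
  commute_p_q : ∀ i j, i ≠ j → Commute (P i) (Q j)

namespace IsWeylSystem

variable {ι A B F : Type*} [Ring A] [Ring B] [FunLike F A B] [RingHomClass F A B] {Q P : ι → A}

theorem map (f : F) (h : IsWeylSystem Q P) :
    IsWeylSystem (fun i => f (Q i)) (fun i => f (P i)) where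
  commute_q i j := (h.commute_q i j).map f
  commute_p i j := (h.commute_p i j).map f
  p_mul_q_self i := by rw [← map_mul, h.p_mul_q_self, map_add, map_mul, map_one]
  commute_p_q i j hij := (h.commute_p_q i j hij).map f

theorem of_map {f : F} (hf : Function.Injective f)
    (h : IsWeylSystem (fun i => f (Q i)) (fun i => f (P i))) : IsWeylSystem Q P where
  commute_q i j := (h.commute_q i j).of_map hf
  commute_p i j := (h.commute_p i j).of_map hf
  p_mul_q_self i := hf (by simpa using h.p_mul_q_self i)
  commute_p_q i j hij := (h.commute_p_q i j hij).of_map hf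

end IsWeylSystem

namespace WeylAlgebra

variable {n : ℕ} {R A : Type*} [CommRing R] [Ring A] [Algebra R A]

/-- The universal property of the Weyl algebra. -/
noncomputable def lift {Q P : Fin n → A} (h : IsWeylSystem Q P) : WeylAlgebra n R →ₐ[R] A :=
  RingQuot.liftAlgHom R ⟨FreeAlgebra.lift R (Sum.elim Q P), fun a b hab => by
    cases hab with
    | q_q i j => simpa [freeQ] using (h.commute_q i j).eq
    | p_p i j => simpa [freeP] using (h.commute_p i j).eq
    | p_q_self i => simpa [freeQ, freeP] using h.p_mul_q_self i
    | p_q i j hij => simpa [freeQ, freeP] using (h.commute_p_q i j hij).eq⟩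

variable {Q P : Fin n → A} (h : IsWeylSystem Q P)

theorem lift_q (i : Fin n) : lift h (q n R i) = Q i :=
  (RingQuot.liftAlgHom_mkAlgHom_apply R (FreeAlgebra.lift R (Sum.elim Q P)) _ _).trans
    (FreeAlgebra.lift_ι_apply _ _)

theorem lift_p (i : Fin n) : lift h (p n R i) = P i :=
  (RingQuot.liftAlgHom_mkAlgHom_apply R (FreeAlgebra.lift R (Sum.elim Q P)) _ _).trans
    (FreeAlgebra.lift_ι_apply _ _)

theorem generator_induction {C : WeylAlgebra n R → Prop}
    (algebraMap : ∀ r, C (algebraMap R _ r)) (q : ∀ i, C (q n R i)) (p : ∀ i, C (p n R i))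
    (mul : ∀ a b, C a → C b → C (a * b)) (add : ∀ a b, C a → C b → C (a + b))
    (a : WeylAlgebra n R) : C a := by
  obtain ⟨f, rfl⟩ := mk_surjective n R a
  induction f using FreeAlgebra.induction with
  | grade0 c => rw [AlgHom.commutes]; exact algebraMap c
  | grade1 i =>
    rcases i with i | i
    exacts [q i, p i]
  | mul a b iha ihb => rw [map_mul]; exact mul _ _ iha ihb
  | add a b iha ihb => rw [map_add]; exact add _ _ iha ihb

variable (n R) in
theorem isWeylSystem : IsWeylSystem (q n R) (p n R) where
  commute_q i j := by simpa [q, commute_iff_eq] using rel_eq n R (Rel.q_q i j)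
  commute_p i j := by simpa [p, commute_iff_eq] using rel_eq n R (Rel.p_p i j)
  p_mul_q_self i := by simpa [p, q] using rel_eq n R (Rel.p_q_self i)
  commute_p_q i j h := by simpa [p, q, commute_iff_eq] using rel_eq n R (Rel.p_q i j h)

end WeylAlgebra

namespace WeylAlgebraLoc

open WeylAlgebra (denominators)

section Generators

variable (n : ℕ) (R : Type*) [CommRing R]

/-- The coordinate `q_i` as a unit of `A'_n(R)`. -/
noncomputable def q (i : Fin n) : (WeylAlgebraLoc n R)ˣ :=
  OreLocalization.numeratorUnit
    (⟨WeylAlgebra.q n R i, Submonoid.subset_closure ⟨i, rfl⟩⟩ : denominators n R)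

/-- The momentum `p_i` in `A'_n(R)`. -/
noncomputable def p (i : Fin n) : WeylAlgebraLoc n R :=
  numeratorAlgHom R (denominators n R) (WeylAlgebra.p n R i)

theorem isWeylSystem : IsWeylSystem (fun i => (q n R i : WeylAlgebraLoc n R)) (p n R) :=
  (WeylAlgebra.isWeylSystem n R).map (numeratorAlgHom R (denominators n R))

end Generators

section UniversalProperty

variable {n : ℕ} {R A : Type*} [CommRing R] [Ring A] [Algebra R A] {Q : Fin n → Aˣ} {P : Fin n → A}

theorem isUnit_weylAlgebra_lift (h : IsWeylSystem (fun i => (Q i : A)) P) :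
    ∀ a ∈ denominators n R, IsUnit (WeylAlgebra.lift (R := R) h a) :=
  fun _ ha => isUnit_map_of_mem_closure _ (by
    rintro _ ⟨i, rfl⟩
    rw [WeylAlgebra.lift_q]
    exact (Q i).isUnit) ha

/-- The universal property of the localized Weyl algebra. -/
noncomputable def lift (h : IsWeylSystem (fun i => (Q i : A)) P) : WeylAlgebraLoc n R →ₐ[R] A :=
  universalAlgHom (WeylAlgebra.lift h) (isUnit_weylAlgebra_lift h)

variable (h : IsWeylSystem (fun i => (Q i : A)) P)

theorem lift_q (i : Fin n) : lift h (q n R i : WeylAlgebraLoc n R) = Q i :=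
  (universalAlgHom_numeratorAlgHom _ _ _).trans (WeylAlgebra.lift_q h i)

theorem lift_p (i : Fin n) : lift h (p n R i) = P i :=
  (universalAlgHom_numeratorAlgHom _ _ _).trans (WeylAlgebra.lift_p h i)

theorem algHom_ext {k B : Type*} [CommRing k] [Algebra k R] [Ring B] [Algebra k B]
    {f g : WeylAlgebraLoc n R →ₐ[k] B}
    (algebraMap : ∀ r, f (algebraMap R _ r) = g (algebraMap R _ r))
    (q : ∀ i, f (q n R i) = g (q n R i)) (p : ∀ i, f (p n R i) = g (p n R i)) : f = g := by
  refine algHom_ext_numeratorAlgHom (AlgHom.ext fun a => ?_)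
  induction a using WeylAlgebra.generator_induction with
  | algebraMap r => exact algebraMap r
  | q i => exact q i
  | p i => exact p i
  | mul a b iha ihb => rw [map_mul, map_mul, iha, ihb]
  | add a b iha ihb => rw [map_add, map_add, iha, ihb]

variable (n R) in
theorem adjoin_generators_eq_top : Algebra.adjoin R
    (⋃ i, {(q n R i : WeylAlgebraLoc n R), ↑(q n R i)⁻¹, p n R i}) = ⊤ := by
  set T := Algebra.adjoin R (⋃ i, {(q n R i : WeylAlgebraLoc n R), ↑(q n R i)⁻¹, p n R i})
  have mem (i : Fin n) : {(q n R i : WeylAlgebraLoc n R), ↑(q n R i)⁻¹, p n R i} ⊆ (T : Set _) :=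
    fun _ ha => Algebra.subset_adjoin (Set.mem_iUnion_of_mem i ha)
  let Q (i : Fin n) : Tˣ :=
    { val := ⟨q n R i, mem i (by simp)⟩
      inv := ⟨↑(q n R i)⁻¹, mem i (by simp)⟩
      val_inv := Subtype.ext (q n R i).mul_inv
      inv_val := Subtype.ext (q n R i).inv_mul }
  let P (i : Fin n) : T := ⟨p n R i, mem i (by simp)⟩
  have h : IsWeylSystem (fun i => (Q i : T)) P :=
    .of_map (f := T.val) Subtype.val_injective (isWeylSystem n R)
  have retract : T.val.comp (lift h) = AlgHom.id R (WeylAlgebraLoc n R) :=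
    algHom_ext (fun r => AlgHom.commutes _ r) (fun i => congrArg T.val (lift_q h i))
      (fun i => congrArg T.val (lift_p h i))
  refine eq_top_iff.2 fun m _ => ?_
  rw [show m = T.val (lift h m) from (DFunLike.congr_fun retract m).symm]
  exact (lift h m).2

end UniversalProperty

section ShiftRepresentation

variable (n : ℕ) (R : Type*) [CommRing R]

/-- The action of `q_i` on functions on the lattice `ℤⁿ`, regarded as formal series in the Laurent
monomials in `n` variables. -/
def shiftQ (i : Fin n) : (Module.End R ((Fin n → ℤ) → R))ˣ where
  val := LinearMap.funLeft R R (· - Pi.single i 1)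
  inv := LinearMap.funLeft R R (· + Pi.single i 1)
  val_inv := LinearMap.ext fun f => funext fun m => congrArg f (sub_add_cancel m _)
  inv_val := LinearMap.ext fun f => funext fun m => congrArg f (add_sub_cancel_right m _)

/-- The action of `p_i` on formal Laurent series, by partial differentiation. -/
def shiftP (i : Fin n) : Module.End R ((Fin n → ℤ) → R) where
  toFun f m := ((m i + 1 : ℤ) : R) * f (m + Pi.single i 1)
  map_add' _ _ := funext fun _ => mul_add _ _ _
  map_smul' _ _ := funext fun _ => mul_left_comm _ _ _

theorem isWeylSystem_shift :
    IsWeylSystem (fun i => (shiftQ n R i : Module.End R ((Fin n → ℤ) → R))) (shiftP n R) where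
  commute_q i j := LinearMap.ext fun f => funext fun m => congrArg f (sub_right_comm m _ _)
  commute_p i j := by
    rcases eq_or_ne i j with rfl | h
    · rfl
    ext1 f
    funext m
    change ((m i + 1 : ℤ) : R) * ((((m + Pi.single i 1 : Fin n → ℤ) j + 1 : ℤ) : R)
        * f (m + Pi.single i 1 + Pi.single j 1))
      = ((m j + 1 : ℤ) : R) * ((((m + Pi.single j 1 : Fin n → ℤ) i + 1 : ℤ) : R)
        * f (m + Pi.single j 1 + Pi.single i 1))
    rw [add_right_comm m, Pi.add_apply, Pi.add_apply, Pi.single_eq_of_ne h,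
      Pi.single_eq_of_ne h.symm, add_zero, add_zero, mul_left_comm]
  p_mul_q_self i := by
    ext1 f
    funext m
    change ((m i + 1 : ℤ) : R) * f (m + Pi.single i 1 - Pi.single i 1)
      = (((m - Pi.single i 1 : Fin n → ℤ) i + 1 : ℤ) : R)
        * f (m - Pi.single i 1 + Pi.single i 1) + f m
    rw [add_sub_cancel_right, sub_add_cancel, Pi.sub_apply, Pi.single_eq_same, sub_add_cancel]
    push_cast
    ring
  commute_p_q i j h := by
    ext1 f
    funext m
    change ((m i + 1 : ℤ) : R) * f (m + Pi.single i 1 - Pi.single j 1)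
      = (((m - Pi.single j 1 : Fin n → ℤ) i + 1 : ℤ) : R) * f (m - Pi.single j 1 + Pi.single i 1)
    rw [Pi.sub_apply, Pi.single_eq_of_ne h, sub_zero, sub_add_eq_add_sub]

theorem algebraMap_injective : Function.Injective (algebraMap R (WeylAlgebraLoc n R)) := by
  refine Function.LeftInverse.injective
    (g := fun a => lift (isWeylSystem_shift n R) a 1 0) fun r => ?_
  beta_reduce
  rw [AlgHom.commutes, Module.algebraMap_end_apply]
  exact mul_one r

end ShiftRepresentation

end WeylAlgebraLoc

/-- The coefficient ring `k[z^{±1}][z']`. -/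
abbrev CentralPolynomial (k : Type*) [Field k] : Type _ := (LaurentPolynomial k)[X]

namespace CentralPolynomial

variable (k : Type*) [Field k]

/-- The variable `z`, as a unit of `k[z^{±1}][z']`. -/
noncomputable def z : (CentralPolynomial k)ˣ where
  val := C (LaurentPolynomial.T 1)
  inv := C (LaurentPolynomial.T (-1))
  val_inv := by rw [← C_mul, ← LaurentPolynomial.T_add]; simp
  inv_val := by rw [← C_mul, ← LaurentPolynomial.T_add]; simp

theorem adjoin_eq_top :
    Algebra.adjoin k {(z k : CentralPolynomial k), ↑(z k)⁻¹, X} = ⊤ := by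
  set T := Algebra.adjoin k {(z k : CentralPolynomial k), ↑(z k)⁻¹, X}
  have z_mem : (z k : CentralPolynomial k) ∈ T := Algebra.subset_adjoin (by simp)
  have z_inv_mem : (↑(z k)⁻¹ : CentralPolynomial k) ∈ T := Algebra.subset_adjoin (by simp)
  have X_mem : (X : CentralPolynomial k) ∈ T := Algebra.subset_adjoin (by simp)
  refine eq_top_iff.2 fun p _ => ?_
  induction p using Polynomial.induction_on with
  | C a =>
    induction a using LaurentPolynomial.induction_on with
    | h_C a => exact T.algebraMap_mem a
    | h_add ha hb => rw [C_add]; exact T.add_mem (ha trivial) (hb trivial)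
    | h_C_mul_T n a h =>
      rw [LaurentPolynomial.T_add, ← mul_assoc, C_mul]
      exact T.mul_mem (h trivial) z_mem
    | h_C_mul_T_Z n a h =>
      rw [sub_eq_add_neg, LaurentPolynomial.T_add, ← mul_assoc, C_mul]
      exact T.mul_mem (h trivial) z_inv_mem
  | add p q hp hq => exact T.add_mem (hp trivial) (hq trivial)
  | monomial n a h =>
    rw [pow_succ, ← mul_assoc]
    exact T.mul_mem (h trivial) X_mem

end CentralPolynomial

instance WeylAlgebraLoc.isScalarTower {n : ℕ} {k R : Type*} [CommRing k] [CommRing R]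
    [Algebra k R] : IsScalarTower k R (WeylAlgebraLoc n R) :=
  .of_algebraMap_eq fun _ => rfl

/-- The Euler system of `A'_2(R)` given by `q_1, q_2`, the Euler operators `q_1 p_1, q_2 p_2` and
two scalars. -/
noncomputable def WeylAlgebraLoc.eulerSystem {R : Type*} [CommRing R] (t : Rˣ) (w : R) :
    EulerSystem (WeylAlgebraLoc 2 R) where
  x := q 2 R 0
  q := q 2 R 1
  z := Units.map (algebraMap R (WeylAlgebraLoc 2 R) : R →* WeylAlgebraLoc 2 R) t
  zPrime := algebraMap R _ w
  zeta := q 2 R 0 * p 2 R 0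
  theta := q 2 R 1 * p 2 R 1
  commute_x_q := (isWeylSystem 2 R).commute_q 0 1
  commute_z := Algebra.commutes _
  commute_zPrime := Algebra.commutes _
  zeta_mul_x := by
    rw [mul_assoc, (isWeylSystem 2 R).p_mul_q_self, mul_add, mul_one]
  commute_zeta_q :=
    ((isWeylSystem 2 R).commute_q 0 1).mul_left ((isWeylSystem 2 R).commute_p_q 0 1 (by decide))
  commute_theta_x :=
    ((isWeylSystem 2 R).commute_q 1 0).mul_left ((isWeylSystem 2 R).commute_p_q 1 0 (by decide))
  theta_mul_q := by
    rw [mul_assoc, (isWeylSystem 2 R).p_mul_q_self, mul_add, mul_one]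
  commute_theta_zeta :=
    (((isWeylSystem 2 R).commute_q 1 0).mul_left
      ((isWeylSystem 2 R).commute_p_q 1 0 (by decide))).mul_right
    (((isWeylSystem 2 R).commute_p_q 0 1 (by decide)).symm.mul_left
      ((isWeylSystem 2 R).commute_p 1 0))

namespace EulerSystem

section WeylSystem

variable {A : Type*} [Ring A] (E : EulerSystem A)

/-- The images of the coordinates of `A'_2` under the homomorphism given by an Euler system. -/
def coordinate : Fin 2 → Aˣ := ![E.x, E.q]

/-- The images of the momenta of `A'_2` under the homomorphism given by an Euler system. -/
def momentum : Fin 2 → A := ![↑E.x⁻¹ * E.zeta, ↑E.q⁻¹ * E.theta]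

theorem isWeylSystem : IsWeylSystem (fun i => (E.coordinate i : A)) E.momentum := by
  have x_q := E.commute_x_q
  have x_q_inv := x_q.units_inv_right
  have zeta_q := E.commute_zeta_q
  have theta_x := E.commute_theta_x
  have p_x_q : Commute (↑E.x⁻¹ * E.zeta) (E.q : A) := x_q.units_inv_left.mul_left zeta_q
  have p_q_x : Commute (↑E.q⁻¹ * E.theta) (E.x : A) := x_q_inv.symm.mul_left theta_x
  have p_p : Commute (↑E.x⁻¹ * E.zeta) (↑E.q⁻¹ * E.theta) :=
    p_x_q.units_inv_right.mul_right (theta_x.units_inv_right.symm.mul_left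
      E.commute_theta_zeta.symm)
  refine ⟨fun i j => ?_, fun i j => ?_, fun i => ?_, fun i j hij => ?_⟩
  · fin_cases i <;> fin_cases j
    exacts [.refl _, x_q, x_q.symm, .refl _]
  · fin_cases i <;> fin_cases j
    exacts [.refl _, p_p, p_p.symm, .refl _]
  · fin_cases i
    · simp [coordinate, momentum, mul_assoc, E.zeta_mul_x, mul_add]
    · simp [coordinate, momentum, mul_assoc, E.theta_mul_q, mul_add]
  · fin_cases i <;> fin_cases j
    exacts [(hij rfl).elim, p_x_q, p_q_x, (hij rfl).elim]

end WeylSystem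

section Scalars

variable (k : Type*) [Field k] {A : Type*} [Ring A] [Algebra k A] (E : EulerSystem A)

/-- The central parameter `z` as a unit of the center. -/
def zCenter : (Subalgebra.center k A)ˣ where
  val := ⟨E.z, Subalgebra.mem_center_iff.2 fun a => (E.commute_z a).symm⟩
  inv := ⟨↑E.z⁻¹, Subalgebra.mem_center_iff.2 fun a => (E.commute_z a).symm.units_inv_right⟩
  val_inv := Subtype.ext E.z.mul_inv
  inv_val := Subtype.ext E.z.inv_mul

/-- The central parameter `z'` as an element of the center. -/
def zPrimeCenter : Subalgebra.center k A :=
  ⟨E.zPrime, Subalgebra.mem_center_iff.2 fun a => (E.commute_zPrime a).symm⟩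

/-- The evaluation of `k[z^{±1}][z']` at the central parameters of an Euler system. -/
noncomputable def scalars : CentralPolynomial k →ₐ[k] Subalgebra.center k A :=
  { eval₂RingHom (LaurentPolynomial.eval₂ (algebraMap k _) (E.zCenter k)) (E.zPrimeCenter k) with
    commutes' := fun c => by
      change eval₂ _ _ (C (LaurentPolynomial.C c)) = _
      rw [eval₂_C, LaurentPolynomial.eval₂_C] }

theorem scalars_apply (r : CentralPolynomial k) : E.scalars k r =
    eval₂ (LaurentPolynomial.eval₂ (algebraMap k _) (E.zCenter k)) (E.zPrimeCenter k) r :=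
  rfl

theorem scalars_z : (E.scalars k (CentralPolynomial.z k) : A) = E.z := by
  simp [scalars_apply, CentralPolynomial.z, zCenter]

theorem scalars_z_inv : (E.scalars k ↑(CentralPolynomial.z k)⁻¹ : A) = ↑E.z⁻¹ := by
  simp [scalars_apply, CentralPolynomial.z, zCenter, Units.inv_mk]

theorem scalars_X : (E.scalars k X : A) = E.zPrime := by
  simp [scalars_apply, zPrimeCenter]

variable {k E} in
theorem eq_scalars {f : CentralPolynomial k →ₐ[k] A} (hz : f (CentralPolynomial.z k) = E.z)
    (hX : f X = E.zPrime) (r : CentralPolynomial k) : f r = E.scalars k r := by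
  refine DFunLike.congr_fun (?_ : f = (Subalgebra.val _).comp (E.scalars k)) r
  refine AlgHom.ext_of_adjoin_eq_top (CentralPolynomial.adjoin_eq_top k) ?_
  rintro _ (rfl | rfl | rfl)
  · exact hz.trans (E.scalars_z k).symm
  · exact (map_units_inv_eq f hz).trans (E.scalars_z_inv k).symm
  · exact hX.trans (E.scalars_X k).symm

variable {k E} in
theorem IsHom.scalars {B : Type*} [Ring B] [Algebra k B] {F : EulerSystem B} {f : A →ₐ[k] B}
    (hf : IsHom E F f) (r : CentralPolynomial k) : f (E.scalars k r) = F.scalars k r :=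
  eq_scalars (f := (f.comp (Subalgebra.val _)).comp (E.scalars k))
    ((congrArg f (E.scalars_z k)).trans hf.z) ((congrArg f (E.scalars_X k)).trans hf.zPrime) r

theorem adjoin_eq_map_range_scalars : Algebra.adjoin k {(E.z : A), ↑E.z⁻¹, E.zPrime} =
    (E.scalars k).range.map (Subalgebra.val _) := by
  rw [← Algebra.map_top, ← CentralPolynomial.adjoin_eq_top, AlgHom.map_adjoin, AlgHom.map_adjoin]
  simp only [Set.image_insert_eq, Set.image_singleton, Subalgebra.val_apply, scalars_z,
    scalars_z_inv, scalars_X]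

end Scalars

section WeylHom

variable (k : Type*) [Field k]

/-- The Euler system of `A'_2(k[z^{±1}][z'])` whose central parameters are the variables. -/
noncomputable def weyl : EulerSystem (WeylAlgebraLoc 2 (CentralPolynomial k)) :=
  WeylAlgebraLoc.eulerSystem (CentralPolynomial.z k) X

theorem scalars_weyl (r : CentralPolynomial k) :
    ((weyl k).scalars k r : WeylAlgebraLoc 2 (CentralPolynomial k)) =
      algebraMap (CentralPolynomial k) _ r :=
  (eq_scalars (f := IsScalarTower.toAlgHom k (CentralPolynomial k) _) rfl rfl r).symm

variable {k} {A : Type*} [Ring A] [Algebra k A] (E : EulerSystem A)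

theorem exists_isHom_weyl : ∃ f, IsHom (k := k) (weyl k) E f := by
  let _ : Algebra (CentralPolynomial k) A :=
    ((Subalgebra.center k A).val.comp (E.scalars k)).toRingHom.toAlgebra'
      fun r a => (Subalgebra.mem_center_iff.1 (E.scalars k r).2 a).symm
  have : IsScalarTower k (CentralPolynomial k) A :=
    .of_algebraMap_eq fun c => (((Subalgebra.center k A).val.comp (E.scalars k)).commutes c).symm
  let f : WeylAlgebraLoc 2 (CentralPolynomial k) →ₐ[CentralPolynomial k] A :=
    WeylAlgebraLoc.lift E.isWeylSystem
  have map_q (i : Fin 2) : f (WeylAlgebraLoc.q 2 (CentralPolynomial k) i) = E.coordinate i :=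
    WeylAlgebraLoc.lift_q E.isWeylSystem i
  have map_p (i : Fin 2) : f (WeylAlgebraLoc.p 2 (CentralPolynomial k) i) = E.momentum i :=
    WeylAlgebraLoc.lift_p E.isWeylSystem i
  refine ⟨f.restrictScalars k, map_q 0, map_q 1, (f.commutes _).trans (E.scalars_z k),
    (f.commutes _).trans (E.scalars_X k), ?_, ?_⟩
  · refine (map_mul f _ _).trans ?_
    rw [map_q, map_p]
    exact E.x.mul_inv_cancel_left _
  · refine (map_mul f _ _).trans ?_
    rw [map_q, map_p]
    exact E.q.mul_inv_cancel_left _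

variable {E}

theorem IsHom.ext_weyl {f h : WeylAlgebraLoc 2 (CentralPolynomial k) →ₐ[k] A}
    (hf : IsHom (weyl k) E f) (hh : IsHom (weyl k) E h) : f = h := by
  refine WeylAlgebraLoc.algHom_ext (fun r => ?_) (fun i => ?_) (fun i => ?_)
  · rw [← scalars_weyl, hf.scalars, hh.scalars]
  · fin_cases i
    exacts [hf.x.trans hh.x.symm, hf.q.trans hh.q.symm]
  · fin_cases i
    · refine ((weyl k).x.isUnit.map f).mul_left_cancel ?_
      exact (map_mul f _ _).symm.trans (hf.zeta.trans <| hh.zeta.symm.trans <|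
        (map_mul h _ _).trans <| congrArg (· * _) (hh.x.trans hf.x.symm))
    · refine ((weyl k).q.isUnit.map f).mul_left_cancel ?_
      exact (map_mul f _ _).symm.trans (hf.theta.trans <| hh.theta.symm.trans <|
        (map_mul h _ _).trans <| congrArg (· * _) (hh.q.trans hf.q.symm))

end WeylHom

end EulerSystem

namespace JordanDoubleLoc

open JordanDouble (gen denominators)

section Elements

variable (k : Type*) [Field k]

/-- `ofD k` as a homomorphism of algebras. -/
noncomputable def ofDAlgHom : JordanDouble k →ₐ[k] JordanDoubleLoc k :=
  numeratorAlgHom k (denominators k)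

theorem ofD_apply (a : JordanDouble k) : ofD k a = ofDAlgHom k a := rfl

/-- `x` as a unit of `𝒟′`. -/
noncomputable def x : (JordanDoubleLoc k)ˣ :=
  OreLocalization.numeratorUnit
    (⟨gen k .x, Submonoid.subset_closure (by simp)⟩ : denominators k)

/-- `q` as a unit of `𝒟′`. -/
noncomputable def q : (JordanDoubleLoc k)ˣ :=
  OreLocalization.numeratorUnit
    (⟨JordanDouble.q k, Submonoid.subset_closure (by simp)⟩ : denominators k)

theorem ofDAlgHom_x : ofDAlgHom k (gen k .x) = x k := rfl

theorem ofDAlgHom_q : ofDAlgHom k (JordanDouble.q k) = q k := rfl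

theorem qInv_eq : qInv k = ↑(q k)⁻¹ := rfl

theorem z_eq : z k = ↑(q k ^ 2) * ofDAlgHom k (gen k .ginv) := by
  rw [z, ofD_apply, JordanDouble.z, map_mul, map_pow, ofDAlgHom_q, Units.val_pow_eq_pow_val]

theorem zInv_eq : zInv k = ofDAlgHom k (gen k .g) * ↑(q k ^ 2)⁻¹ := by
  rw [zInv, qInv_eq, ← Units.val_pow_eq_pow_val, inv_pow, ofD_apply]

theorem z_mul_zInv : z k * zInv k = 1 := by
  rw [z_eq, zInv_eq, mul_assoc, ← mul_assoc (ofDAlgHom k _), ← map_mul, JordanDouble.ginv_mul_g,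
    map_one, one_mul, Units.mul_inv]

theorem zInv_mul_z : zInv k * z k = 1 := by
  rw [z_eq, zInv_eq, mul_assoc, Units.inv_mul_cancel_left, ← map_mul, JordanDouble.g_mul_ginv,
    map_one]

/-- `z` as a unit of `𝒟′`. -/
noncomputable def zUnit : (JordanDoubleLoc k)ˣ := ⟨z k, zInv k, z_mul_zInv k, zInv_mul_z k⟩

theorem ofDAlgHom_s : ofDAlgHom k (JordanDouble.s k) = q k * zPrime k := by
  rw [zPrime, qInv_eq, Units.mul_inv_cancel_left, ofD_apply]

/-- The element of `𝒟′` acting on `q` as an Euler operator and commuting with `x`. -/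
noncomputable def theta : JordanDoubleLoc k :=
  -((2 : k) • (↑(x k)⁻¹ * ofDAlgHom k (gen k .y))) - ofDAlgHom k (gen k .zeta)

theorem commute_x_q : Commute (x k : JordanDoubleLoc k) (q k) :=
  (JordanDouble.q_commute_x k).symm.map (ofDAlgHom k)

theorem commute_zeta_q : Commute (ofDAlgHom k (gen k .zeta)) (q k) :=
  (JordanDouble.q_commute_zeta k).symm.map (ofDAlgHom k)

theorem zeta_mul_x : ofDAlgHom k (gen k .zeta) * x k
    = x k * ofDAlgHom k (gen k .zeta) + x k := by
  simpa only [map_mul, map_add, ofDAlgHom_x] using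
    congrArg (ofDAlgHom k) (JordanDouble.zeta_mul_x k)

theorem x_mul_theta_add_zeta : x k * (theta k + ofDAlgHom k (gen k .zeta))
    = -((2 : k) • ofDAlgHom k (gen k .y)) := by
  rw [theta, sub_add_cancel, mul_neg, mul_smul_comm, Units.mul_inv_cancel_left]

theorem commute_theta_zeta : Commute (theta k) (ofDAlgHom k (gen k .zeta)) := by
  have h : Commute (↑(x k)⁻¹ * ofDAlgHom k (gen k .y)) (ofDAlgHom k (gen k .zeta)) := by
    rw [commute_iff_eq, ← Units.mul_right_inj (x k)]
    have zeta_mul_y : ofDAlgHom k (gen k .zeta) * ofDAlgHom k (gen k .y)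
        = ofDAlgHom k (gen k .y) * ofDAlgHom k (gen k .zeta) + ofDAlgHom k (gen k .y) := by
      simpa only [map_mul, map_add] using congrArg (ofDAlgHom k) (JordanDouble.zeta_mul_y k)
    rw [mul_assoc, Units.mul_inv_cancel_left, ← mul_assoc (x k : JordanDoubleLoc k),
      eq_sub_of_add_eq (zeta_mul_x k).symm, sub_mul, mul_assoc, Units.mul_inv_cancel_left,
      zeta_mul_y, add_sub_cancel_right]
  exact ((h.smul_left _).neg_left).sub_left (Commute.refl _)

variable [CharZero k]

theorem commute_theta_x : Commute (theta k) (x k) := by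
  have y_mul_x : ofDAlgHom k (gen k .y) * x k
      = x k * ofDAlgHom k (gen k .y) - (1 / 2 : k) • (x k * x k : JordanDoubleLoc k) := by
    simpa only [map_mul, map_sub, map_smul, ofDAlgHom_x] using
      congrArg (ofDAlgHom k) (JordanDouble.y_mul_x k)
  rw [commute_iff_eq, theta, sub_mul, mul_sub, neg_mul, mul_neg, smul_mul_assoc, mul_smul_comm,
    Units.mul_inv_cancel_left, mul_assoc, y_mul_x, zeta_mul_x, mul_sub, mul_smul_comm,
    Units.inv_mul_cancel_left, Units.inv_mul_cancel_left]
  module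

theorem theta_mul_q : theta k * q k = q k * theta k + q k := by
  have q_mul_y : q k * ofDAlgHom k (gen k .y)
      = ofDAlgHom k (gen k .y) * q k + (1 / 2 : k) • (x k * q k : JordanDoubleLoc k) := by
    have h := congrArg (ofDAlgHom k) (JordanDouble.semiconjBy_q_twist k (gen k .y)).eq
    simpa only [JordanDouble.twist_gen, JordanDouble.twistGen, add_mul, smul_mul_assoc, map_mul,
      map_add, map_smul, ofDAlgHom_x, ofDAlgHom_q] using h
  rw [theta, sub_mul, mul_sub, neg_mul, mul_neg, smul_mul_assoc, mul_smul_comm,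
    ← mul_assoc (q k : JordanDoubleLoc k), (commute_x_q k).symm.units_inv_right.eq, mul_assoc,
    mul_assoc, q_mul_y, mul_add, mul_smul_comm, Units.inv_mul_cancel_left, (commute_zeta_q k).eq]
  module

theorem commute_z (a : JordanDoubleLoc k) : Commute (z k) a :=
  commute_of_commute_numeratorAlgHom (k := k)
    (fun b => (JordanDouble.commute_z k b).map (ofDAlgHom k)) a

theorem commute_zPrime (a : JordanDoubleLoc k) : Commute (zPrime k) a := by
  refine commute_of_commute_numeratorAlgHom (k := k) (fun b => ?_) a
  have hs := (JordanDouble.semiconjBy_s_twist k b).map (ofDAlgHom k)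
  have hq : SemiconjBy (q k : JordanDoubleLoc k) _ _ :=
    (JordanDouble.semiconjBy_q_twist k b).map (ofDAlgHom k)
  exact hq.units_inv_symm_left.mul_left hs

theorem zPrime_eq : zPrime k = ofD k (JordanDouble.s k) * qInv k := by
  have h : Commute (ofDAlgHom k (JordanDouble.s k)) (q k) :=
    (JordanDouble.commute_s_q k).map (ofDAlgHom k)
  exact h.units_inv_right.eq.symm

/-- The Euler system of `𝒟′` formed by `x`, `q`, the central elements `z`, `z'` and the Euler
operators `ζ` and `-2 x⁻¹ y - ζ`. -/
noncomputable def eulerSystem : EulerSystem (JordanDoubleLoc k) where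
  x := x k
  q := q k
  z := zUnit k
  zPrime := zPrime k
  zeta := ofDAlgHom k (gen k .zeta)
  theta := theta k
  commute_x_q := commute_x_q k
  commute_z := commute_z k
  commute_zPrime := commute_zPrime k
  zeta_mul_x := zeta_mul_x k
  commute_zeta_q := commute_zeta_q k
  commute_theta_x := commute_theta_x k
  theta_mul_q := theta_mul_q k
  commute_theta_zeta := commute_theta_zeta k

end Elements

section Generators

variable (k : Type*) [Field k] [CharZero k]

theorem ofDAlgHom_g : ofDAlgHom k (gen k .g) = (eulerSystem k).g := by
  have h : ofDAlgHom k (gen k .g) = zInv k * ↑(q k ^ 2) := by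
    rw [zInv_eq, Units.inv_mul_cancel_right]
  exact h

theorem ofDAlgHom_ginv : ofDAlgHom k (gen k .ginv) = ↑(eulerSystem k).g⁻¹ := by
  refine Units.eq_inv_of_mul_eq_one_left ?_
  rw [← ofDAlgHom_g, ← map_mul, JordanDouble.g_mul_ginv, map_one]

theorem ofDAlgHom_u :
    ofDAlgHom k (gen k .u) = ↑(x k)⁻¹ * (q k - 2 - 2 * (eulerSystem k).g) := by
  have hq : (q k : JordanDoubleLoc k)
      = x k * ofDAlgHom k (gen k .u) + (2 + 2 * (eulerSystem k).g) := by
    rw [← ofDAlgHom_q, ← ofDAlgHom_g, ← ofDAlgHom_x, JordanDouble.q, JordanDouble.u_mul_x,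
      mul_add, mul_one]
    simp only [map_add, map_mul, map_ofNat]
  rw [hq, sub_sub, add_sub_cancel_right, Units.inv_mul_cancel_left]

theorem ofDAlgHom_y : ofDAlgHom k (gen k .y)
    = -((1 / 2 : k) • (x k * (theta k + ofDAlgHom k (gen k .zeta)))) := by
  rw [x_mul_theta_add_zeta]
  module

theorem ofDAlgHom_v : ofDAlgHom k (gen k .v)
    = ↑(x k)⁻¹ * (q k * zPrime k + 2 + 2 * (eulerSystem k).g
      + ((1 / 2 : k) • (q k : JordanDoubleLoc k) - 1 - (eulerSystem k).g)
        * (theta k + ofDAlgHom k (gen k .zeta))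
      + ((1 / 2 : k) • (q k : JordanDoubleLoc k) - 2 * (eulerSystem k).g)
        * ofDAlgHom k (gen k .zeta)) := by
  have two_eq : (2 : JordanDoubleLoc k) = 1 + 1 := one_add_one_eq_two.symm
  have u_mul_x : ofDAlgHom k (gen k .u) * x k = q k - 2 - 2 * (eulerSystem k).g := by
    rw [← ofDAlgHom_x, ← map_mul, JordanDouble.u_mul_x, map_mul, ofDAlgHom_u, ofDAlgHom_x,
      Units.mul_inv_cancel_left]
  have u_mul_y : ofDAlgHom k (gen k .u) * ofDAlgHom k (gen k .y)
      = -((1 / 2 : k) • ((q k - 2 - 2 * (eulerSystem k).g)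
        * (theta k + ofDAlgHom k (gen k .zeta)))) := by
    rw [ofDAlgHom_y, mul_neg, mul_smul_comm, ← mul_assoc, u_mul_x]
  rw [Units.eq_inv_mul_iff_mul_eq, ← ofDAlgHom_s, JordanDouble.s]
  simp only [map_add, map_sub, map_mul, map_neg, map_smul, map_ofNat, map_one, ofDAlgHom_g,
    ofDAlgHom_x, u_mul_x, u_mul_y]
  simp only [mul_add, add_mul, sub_mul, neg_mul, smul_mul_assoc, smul_sub, smul_add, one_mul,
    mul_one, two_eq]
  module

theorem hom_eulerSystem : (eulerSystem k).hom k = ofDAlgHom k := by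
  refine JordanDouble.algHom_ext fun i => ((eulerSystem k).hom_gen k i).trans ?_
  cases i with
  | u => exact (ofDAlgHom_u k).symm
  | g => exact (ofDAlgHom_g k).symm
  | ginv => exact (ofDAlgHom_ginv k).symm
  | x => rfl
  | zeta => rfl
  | y => exact (ofDAlgHom_y k).symm
  | v => exact (ofDAlgHom_v k).symm

end Generators

section UniversalProperty

open EulerSystem (IsHom)

variable {k : Type*} [Field k] [CharZero k] {A : Type*} [Ring A] [Algebra k A] {E : EulerSystem A}

theorem _root_.EulerSystem.IsHom.ext_jordan {f h : JordanDoubleLoc k →ₐ[k] A}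
    (hf : IsHom (eulerSystem k) E f) (hh : IsHom (eulerSystem k) E h) : f = h := by
  have comp_ofDAlgHom : f.comp (ofDAlgHom k) = h.comp (ofDAlgHom k) := by
    rw [← hom_eulerSystem, hf.comp_hom, hh.comp_hom]
  exact algHom_ext_numeratorAlgHom comp_ofDAlgHom

variable (k E)

theorem isUnit_hom : ∀ a ∈ denominators k, IsUnit (E.hom k a) :=
  fun _ ha => isUnit_map_of_mem_closure _ (by
    rintro _ (rfl | rfl)
    · rw [E.hom_gen k]
      exact E.x.isUnit
    · rw [E.hom_q k]
      exact E.q.isUnit) ha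

theorem exists_isHom : ∃ f : JordanDoubleLoc k →ₐ[k] A, IsHom (eulerSystem k) E f := by
  let f : JordanDoubleLoc k →ₐ[k] A := universalAlgHom (E.hom k) (isUnit_hom k E)
  have f_ofDAlgHom (a : JordanDouble k) : f (ofDAlgHom k a) = E.hom k a :=
    universalAlgHom_numeratorAlgHom _ _ a
  have hx : f (x k) = E.x := (f_ofDAlgHom _).trans (E.hom_gen k .x)
  have hq : f (q k) = E.q := (f_ofDAlgHom _).trans (E.hom_q k)
  have hζ : f (ofDAlgHom k (gen k .zeta)) = E.zeta := (f_ofDAlgHom _).trans (E.hom_gen k .zeta)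
  refine ⟨f, hx, hq, (f_ofDAlgHom _).trans (E.hom_z k), ?_, hζ, ?_⟩
  · refine (Units.mul_right_inj E.q).1 ?_
    rw [← E.hom_s k, ← f_ofDAlgHom, ofDAlgHom_s, map_mul, hq]
    rfl
  · have h := congrArg f (x_mul_theta_add_zeta k)
    rw [map_mul, map_add, hx, hζ, map_neg, map_smul, f_ofDAlgHom, E.hom_gen k,
      EulerSystem.genImage, smul_neg, neg_neg, smul_smul, mul_one_div_cancel two_ne_zero,
      one_smul] at h
    exact add_right_cancel ((Units.mul_right_inj E.x).1 h)

end UniversalProperty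

end JordanDoubleLoc

section Adjoin

variable {k A : Type*} [CommRing k] [Ring A] [Algebra k A]

theorem mem_of_mem_adjoin_of_mul_mem {s : Set A} {N : Submodule k A} (one : (1 : A) ∈ N)
    (mul : ∀ a ∈ s, ∀ v ∈ N, a * v ∈ N) {c : A} (hc : c ∈ Algebra.adjoin k s) : c ∈ N := by
  rw [← Subalgebra.mem_toSubmodule, Algebra.adjoin_eq_span] at hc
  refine Submodule.span_le.2 (fun a ha => ?_) hc
  induction ha using Submonoid.closure_induction_left with
  | one => exact one
  | mul_left a ha v _ hv => exact mul a ha v hv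

/-- The subspace `B a` of left multiples of `a` by elements of the subalgebra `B`. -/
def leftMultiples (B : Subalgebra k A) (a : A) : Submodule k A :=
  B.toSubmodule.map (LinearMap.mulRight k a)

theorem mul_mem_leftMultiples {B : Subalgebra k A} {b : A} (hb : b ∈ B) (a : A) :
    b * a ∈ leftMultiples B a :=
  ⟨b, hb, rfl⟩

theorem commutator_mem_adjoin {s : Set A} {p : A}
    (hs : ∀ a ∈ s, p * a - a * p ∈ Algebra.adjoin k s) {b : A} (hb : b ∈ Algebra.adjoin k s) :
    p * b - b * p ∈ Algebra.adjoin k s := by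
  induction hb using Algebra.adjoin_induction with
  | mem a ha => exact hs a ha
  | algebraMap r =>
    rw [Algebra.commutes, sub_self]
    exact zero_mem _
  | add a b _ _ iha ihb =>
    rw [mul_add, add_mul, add_sub_add_comm]
    exact add_mem iha ihb
  | mul a b ha hb iha ihb =>
    have leibniz : p * (a * b) - a * b * p = (p * a - a * p) * b + a * (p * b - b * p) := by
      noncomm_ring
    rw [leibniz]
    exact add_mem (mul_mem iha hb) (mul_mem ha ihb)

theorem mem_adjoin_range_algebraMap_union {k R A : Type*} [CommSemiring k] [CommSemiring R]
    [Semiring A] [Algebra k A] [Algebra R A] {s : Set A} {a : A}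
    (ha : a ∈ Algebra.adjoin R s) : a ∈ Algebra.adjoin k (Set.range (algebraMap R A) ∪ s) := by
  induction ha using Algebra.adjoin_induction with
  | mem a ha => exact Algebra.subset_adjoin (Or.inr ha)
  | algebraMap r => exact Algebra.subset_adjoin (Or.inl ⟨r, rfl⟩)
  | add a b _ _ ha hb => exact add_mem ha hb
  | mul a b _ _ ha hb => exact mul_mem ha hb

end Adjoin

section EigenspaceDecomposition

variable {k A ι : Type*} [Field k] [Ring A] [Algebra k A]

theorem mem_of_mem_iSup_of_mem_eigenspace {M : Type*} [AddCommGroup M] [Module k M]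
    {f : Module.End k M} {V : ι → Submodule k M} {χ : ι → k} (hχ : Function.Injective χ)
    (hV : ∀ i, V i ≤ f.eigenspace (χ i)) {c : M} (hc : c ∈ ⨆ i, V i) {i : ι}
    (hi : c ∈ f.eigenspace (χ i)) : c ∈ V i := by
  rw [iSup_split_single _ i, Submodule.mem_sup] at hc
  obtain ⟨a, ha, b, hb, rfl⟩ := hc
  have b_mem_others : b ∈ ⨆ j, ⨆ _ : j ≠ i, f.eigenspace (χ j) :=
    (iSup₂_mono fun j _ => hV j : ⨆ j, ⨆ _ : j ≠ i, V j ≤ _) hb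
  have b_mem : b ∈ f.eigenspace (χ i) := (Submodule.add_mem_iff_right _ (hV i ha)).1 hi
  have b_eq_zero : b = 0 :=
    Submodule.disjoint_def.1 ((f.eigenspaces_iSupIndep.comp hχ) i) b b_mem b_mem_others
  rwa [b_eq_zero, add_zero]

theorem mem_of_mem_adjoin_of_mem_eigenspace {B : Subalgebra k A} {s : Set A} {e : ι → A} {i : ι}
    (he : e i = 1) (hs : ∀ a ∈ s, ∀ j, ∀ b ∈ B, a * (b * e j) ∈ ⨆ l, leftMultiples B (e l))
    {f : Module.End k A} {χ : ι → k} (hχ : Function.Injective χ)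
    (hf : ∀ j, ∀ b ∈ B, f (b * e j) = χ j • (b * e j)) {c : A} (hc : c ∈ Algebra.adjoin k s)
    (hfc : f c = χ i • c) : c ∈ B := by
  have one_mem : (1 : A) ∈ ⨆ l, leftMultiples B (e l) :=
    Submodule.mem_iSup_of_mem i ⟨1, B.one_mem, by simp [he]⟩
  have mul_mem : ∀ a ∈ s, ⨆ l, leftMultiples B (e l) ≤
      (⨆ l, leftMultiples B (e l)).comap (LinearMap.mulLeft k a) := by
    refine fun a ha => iSup_le fun j => ?_
    rintro _ ⟨b, hb, rfl⟩
    exact hs a ha j b hb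
  have le_eigenspace (j : ι) : leftMultiples B (e j) ≤ f.eigenspace (χ j) := by
    rintro _ ⟨b, hb, rfl⟩
    exact Module.End.mem_eigenspace_iff.2 (hf j b hb)
  obtain ⟨b, hb, rfl⟩ := mem_of_mem_iSup_of_mem_eigenspace hχ le_eigenspace
    (mem_of_mem_adjoin_of_mul_mem one_mem mul_mem hc) (Module.End.mem_eigenspace_iff.2 hfc)
  simpa [he] using hb

end EigenspaceDecomposition

section Elimination

variable {k A : Type*} [Field k] [CharZero k] [Ring A] [Algebra k A] {B : Subalgebra k A} {c : A}

theorem pow_mul_mul_of_mul_eq_add_one {A : Type*} [Ring A] {p q : A} (h : p * q = q * p + 1)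
    (d : ℕ) : p ^ d * q * p = q * p ^ d * p + d • p ^ d := by
  induction d with
  | zero => simp
  | succ d ih =>
    calc p ^ (d + 1) * q * p = p * (p ^ d * q * p) := by rw [pow_succ']; noncomm_ring
      _ = p * q * (p ^ d * p) + d • (p * p ^ d) := by rw [ih]; noncomm_ring
      _ = q * p ^ (d + 1) * p + (d + 1) • p ^ (d + 1) := by
        rw [h, ← pow_succ, ← pow_succ', succ_nsmul', add_mul, one_mul, add_assoc, mul_assoc q p,
          ← pow_succ', mul_assoc q, ← pow_succ]

-- On `b pᵈ` with `b ∈ B`, the operator `a ↦ (a q - q a) p` has the eigenvalue `d`.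
theorem mem_of_mem_adjoin_insert_momentum {p q : A} (hpq : p * q = q * p + 1)
    (hBq : ∀ b ∈ B, Commute b q) (hBp : ∀ b ∈ B, p * b - b * p ∈ B)
    (hc : c ∈ Algebra.adjoin k (insert p (B : Set A))) (hcq : Commute c q) : c ∈ B := by
  let f : Module.End k A :=
    LinearMap.mulRight k p ∘ₗ (LinearMap.mulRight k q - LinearMap.mulLeft k q)
  refine mem_of_mem_adjoin_of_mem_eigenspace (e := fun d : ℕ => p ^ d) (i := 0) (f := f)
    (χ := Nat.cast) (pow_zero p) ?_ Nat.cast_injective ?_ hc ?_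
  · rintro a (rfl | ha) d b hb
    · have split : a * (b * a ^ d) = b * a ^ (d + 1) + (a * b - b * a) * a ^ d := by
        rw [pow_succ']
        noncomm_ring
      rw [split]
      exact add_mem (Submodule.mem_iSup_of_mem _ (mul_mem_leftMultiples hb _))
        (Submodule.mem_iSup_of_mem _ (mul_mem_leftMultiples (hBp b hb) _))
    · rw [← mul_assoc]
      exact Submodule.mem_iSup_of_mem d (mul_mem_leftMultiples (mul_mem ha hb) _)
  · intro d b hb
    change (b * p ^ d * q - q * (b * p ^ d)) * p = (d : k) • (b * p ^ d)
    rw [Nat.cast_smul_eq_nsmul, ← mul_smul_comm, ← mul_assoc q, ← (hBq b hb).eq,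
      ← add_sub_cancel_left (q * p ^ d * p) (d • p ^ d), ← pow_mul_mul_of_mul_eq_add_one hpq]
    noncomm_ring
  · change (c * q - q * c) * p = ((0 : ℕ) : k) • c
    rw [hcq.eq, sub_self, zero_mul, Nat.cast_zero, zero_smul]

theorem semiconjBy_zpow_add_intCast {A : Type*} [Ring A] {q : Aˣ} {t : A}
    (h : SemiconjBy (q : A) (t + 1) t) (m : ℤ) : SemiconjBy (↑(q ^ m) : A) (t + m) t := by
  have shift (m : ℤ) : SemiconjBy (q : A) (t + (m + 1 : ℤ)) (t + m) := by
    rw [Int.cast_add, Int.cast_one, add_comm (m : A), ← add_assoc]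
    exact h.add_right (Int.commute_cast _ m)
  induction m using Int.induction_on with
  | zero => simp
  | succ m ih =>
    rw [zpow_add_one, Units.val_mul]
    exact ih.mul_left (shift m)
  | pred m ih =>
    rw [zpow_sub_one, Units.val_mul]
    have shift_inv := (shift (-m - 1)).units_inv_symm_left
    rw [sub_add_cancel] at shift_inv
    exact ih.mul_left shift_inv

-- On `b qᵐ` with `b ∈ B`, the operator `a ↦ t a - a t` has the eigenvalue `m`.
theorem mem_of_mem_adjoin_insert_coordinate {q : Aˣ} {t : A} (htq : SemiconjBy (q : A) (t + 1) t)
    (hBq : ∀ b ∈ B, Commute b (q : A)) (hBt : ∀ b ∈ B, Commute b t)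
    (hc : c ∈ Algebra.adjoin k (insert (q : A) (insert ↑q⁻¹ (B : Set A)))) (hct : Commute c t) :
    c ∈ B := by
  let f : Module.End k A := LinearMap.mulLeft k t - LinearMap.mulRight k t
  refine mem_of_mem_adjoin_of_mem_eigenspace (e := fun m : ℤ => (↑(q ^ m) : A)) (i := 0) (f := f)
    (χ := Int.cast) (by simp) ?_ Int.cast_injective ?_ hc ?_
  · rintro a (rfl | rfl | ha) m b hb
    · refine Submodule.mem_iSup_of_mem (1 + m) ⟨b, hb, ?_⟩
      change b * ↑(q ^ (1 + m)) = q * (b * ↑(q ^ m))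
      rw [zpow_one_add, Units.val_mul, (hBq b hb).left_comm]
    · refine Submodule.mem_iSup_of_mem (-1 + m) ⟨b, hb, ?_⟩
      change b * ↑(q ^ (-1 + m)) = ↑q⁻¹ * (b * ↑(q ^ m))
      rw [zpow_add, zpow_neg_one, Units.val_mul, (hBq b hb).units_inv_right.left_comm]
    · rw [← mul_assoc]
      exact Submodule.mem_iSup_of_mem m (mul_mem_leftMultiples (mul_mem ha hb) _)
  · intro m b hb
    change t * (b * ↑(q ^ m)) - b * ↑(q ^ m) * t = (m : k) • (b * (↑(q ^ m) : A))
    rw [(hBt b hb).symm.left_comm, ← (semiconjBy_zpow_add_intCast htq m).eq, mul_add, mul_add,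
      mul_assoc, add_sub_cancel_left, ← (Int.cast_commute m _).eq,
      (Int.cast_commute m b).symm.left_comm, Algebra.smul_def, map_intCast]
  · change t * c - c * t = ((0 : ℤ) : k) • c
    rw [hct.eq, sub_self, Int.cast_zero, zero_smul]

end Elimination

section Center

variable {k A ι : Type*} [Field k] [CharZero k] [Ring A] [Algebra k A] {Q : ι → Aˣ} {P : ι → A}

-- A central element cannot involve the last pair: commutation with `q` removes the powers of `p`,
-- and commutation with the Euler operator `q p` then removes the powers of `q`.
theorem mem_of_mem_center_of_mem_adjoin_pair {B : Subalgebra k A} {q : Aˣ} {p : A}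
    (hpq : p * q = q * p + 1) (hBq : ∀ b ∈ B, Commute b (q : A)) (hBp : ∀ b ∈ B, Commute b p)
    {c : A} (hc : c ∈ Subalgebra.center k A)
    (hcB : c ∈ Algebra.adjoin k ((B : Set A) ∪ {(q : A), ↑q⁻¹, p})) : c ∈ B := by
  have commute_c (a : A) : Commute c a := (Subalgebra.mem_center_iff.1 hc a).symm
  have euler : SemiconjBy (q : A) (q * p + 1) (q * p) := by
    rw [SemiconjBy, mul_assoc, hpq]
  have p_inv : p * ↑q⁻¹ - ↑q⁻¹ * p = -(↑q⁻¹ * ↑q⁻¹ : A) := by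
    have h : p = q * p * ↑q⁻¹ + ↑q⁻¹ := by
      rw [← add_one_mul, ← hpq, q.mul_inv_cancel_right]
    nth_rw 2 [h]
    rw [mul_add, mul_assoc (q : A), q.inv_mul_cancel_left, sub_add_cancel_left]
  refine mem_of_mem_adjoin_insert_coordinate euler hBq
    (fun b hb => (hBq b hb).mul_right (hBp b hb)) ?_ (commute_c (q * p))
  refine mem_of_mem_adjoin_insert_momentum hpq (fun b hb => ?_) (fun b hb => ?_) ?_ (commute_c q)
  · refine (Algebra.commute_of_mem_adjoin_of_forall_mem_commute hb ?_).symm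
    rintro a (rfl | rfl | ha)
    exacts [.refl _, .units_inv_right (.refl _), (hBq a ha).symm]
  · refine commutator_mem_adjoin ?_ hb
    rintro a (rfl | rfl | ha)
    · rw [hpq, add_sub_cancel_left]
      exact one_mem _
    · rw [p_inv]
      have : (↑q⁻¹ : A) ∈ Algebra.adjoin k (insert (q : A) (insert ↑q⁻¹ (B : Set A))) :=
        Algebra.subset_adjoin (by simp)
      exact neg_mem (mul_mem this this)
    · rw [(hBp a ha).eq, sub_self]
      exact zero_mem _
  · refine Algebra.adjoin_mono ?_ hcB
    rintro a (ha | rfl | rfl | rfl)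
    · exact Or.inr (Algebra.subset_adjoin (by simp [ha]))
    · exact Or.inr (Algebra.subset_adjoin (by simp))
    · exact Or.inr (Algebra.subset_adjoin (by simp))
    · exact Or.inl rfl

theorem IsWeylSystem.mem_of_mem_center_of_mem_adjoin (h : IsWeylSystem (fun i => (Q i : A)) P)
    {B : Subalgebra k A} (hB : B ≤ Subalgebra.center k A) {c : A}
    (hc : c ∈ Subalgebra.center k A) (s : Finset ι)
    (hcB : c ∈ Algebra.adjoin k ((B : Set A) ∪ ⋃ i ∈ s, {(Q i : A), ↑(Q i)⁻¹, P i})) : c ∈ B := by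
  classical
  induction s using Finset.induction_on with
  | empty => simpa [Algebra.adjoin_eq] using hcB
  | insert j s hj ih =>
    have ne {i : ι} (hi : i ∈ s) : i ≠ j := fun hij => hj (hij ▸ hi)
    have commute_adjoin {a : A} (hQ : ∀ i ∈ s, Commute a (Q i)) (hP : ∀ i ∈ s, Commute a (P i)) :
        ∀ b ∈ Algebra.adjoin k ((B : Set A) ∪ ⋃ i ∈ s, {(Q i : A), ↑(Q i)⁻¹, P i}),
          Commute b a := by
      refine fun b hb => (Algebra.commute_of_mem_adjoin_of_forall_mem_commute hb ?_).symm
      rintro b (hb | hb)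
      · exact Subalgebra.mem_center_iff.1 (hB hb) a
      obtain ⟨i, hi, rfl | rfl | rfl⟩ := Set.mem_iUnion₂.1 hb
      exacts [hQ i hi, (hQ i hi).units_inv_right, hP i hi]
    refine ih (mem_of_mem_center_of_mem_adjoin_pair (h.p_mul_q_self j)
      (commute_adjoin (fun i _ => h.commute_q j i) fun i hi => (h.commute_p_q i j (ne hi)).symm)
      (commute_adjoin (fun i hi => h.commute_p_q j i (ne hi).symm) fun i _ => h.commute_p j i)
      hc (Algebra.adjoin_mono ?_ hcB))
    · rintro a (ha | ha)
      · exact Or.inl (Algebra.subset_adjoin (Or.inl ha))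
      rw [Finset.set_biUnion_insert] at ha
      exact ha.symm.imp (fun ha => Algebra.subset_adjoin (Or.inr ha)) id

theorem WeylAlgebraLoc.center_eq_range_algebraMap (n : ℕ) (k R : Type*) [Field k] [CharZero k]
    [CommRing R] [Algebra k R] : Subalgebra.center k (WeylAlgebraLoc n R) =
      (IsScalarTower.toAlgHom k R (WeylAlgebraLoc n R)).range := by
  have range_le : (IsScalarTower.toAlgHom k R (WeylAlgebraLoc n R)).range ≤
      Subalgebra.center k (WeylAlgebraLoc n R) := by
    rintro _ ⟨r, rfl⟩
    exact Subalgebra.mem_center_iff.2 fun a => (Algebra.commutes r a).symm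
  refine le_antisymm (fun c hc => ?_) range_le
  have c_mem : c ∈ Algebra.adjoin R _ := adjoin_generators_eq_top n R ▸ Algebra.mem_top
  refine (isWeylSystem n R).mem_of_mem_center_of_mem_adjoin range_le hc Finset.univ ?_
  simpa using! mem_adjoin_range_algebraMap_union (k := k) c_mem

end Center

namespace JordanDoubleLoc

open EulerSystem

variable (k : Type*) [Field k] [CharZero k]

theorem exists_algEquiv_isHom :
    ∃ e : JordanDoubleLoc k ≃ₐ[k] WeylAlgebraLoc 2 (CentralPolynomial k),
      IsHom (eulerSystem k) (weyl k) (e : JordanDoubleLoc k →ₐ[k] _) := by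
  obtain ⟨f, hf⟩ := exists_isHom k (weyl k)
  obtain ⟨h, hh⟩ := exists_isHom_weyl (k := k) (eulerSystem k)
  exact ⟨.ofAlgHom f h ((hf.comp hh).ext_weyl (.id _)) ((hh.comp hf).ext_jordan (.id _)), hf⟩

variable {k} {e : JordanDoubleLoc k ≃ₐ[k] WeylAlgebraLoc 2 (CentralPolynomial k)}

theorem algEquiv_scalars (he : IsHom (eulerSystem k) (weyl k) (e : JordanDoubleLoc k →ₐ[k] _))
    (r : CentralPolynomial k) : e ((eulerSystem k).scalars k r) = algebraMap _ _ r :=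
  (he.scalars r).trans (scalars_weyl k r)

theorem bijective_scalars : Function.Bijective ((eulerSystem k).scalars k) := by
  obtain ⟨e, he⟩ := exists_algEquiv_isHom k
  refine ⟨fun r r' h => WeylAlgebraLoc.algebraMap_injective 2 _ ?_, fun c => ?_⟩
  · rw [← algEquiv_scalars he, ← algEquiv_scalars he, h]
  · have map_c_mem : e c ∈ Subalgebra.center k _ := Subalgebra.mem_center_iff.2 fun a => by
      obtain ⟨b, rfl⟩ := e.surjective a
      rw [← map_mul, ← map_mul, Subalgebra.mem_center_iff.1 c.2]
    rw [WeylAlgebraLoc.center_eq_range_algebraMap] at map_c_mem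
    obtain ⟨r, hr⟩ := map_c_mem
    exact ⟨r, Subtype.ext (e.injective ((algEquiv_scalars he r).trans hr))⟩

theorem adjoin_eq_center : Algebra.adjoin k {z k, zInv k, zPrime k} =
    Subalgebra.center k (JordanDoubleLoc k) := by
  refine ((eulerSystem k).adjoin_eq_map_range_scalars k).trans ?_
  rw [(AlgHom.range_eq_top _).2 bijective_scalars.2, Algebra.map_top, Subalgebra.range_val]

end JordanDoubleLoc

theorem theorem4p7_general (k : Type*) [Field k] [CharZero k] :
    IsNormalElement (JordanDouble.q k) ∧
    JordanDoubleLoc.z k * JordanDoubleLoc.zInv k = 1 ∧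
    JordanDoubleLoc.zInv k * JordanDoubleLoc.z k = 1 ∧
    JordanDoubleLoc.zPrime k
      = JordanDoubleLoc.ofD k (JordanDouble.s k) * JordanDoubleLoc.qInv k ∧
    Algebra.adjoin k {JordanDoubleLoc.z k, JordanDoubleLoc.zInv k, JordanDoubleLoc.zPrime k}
      = Subalgebra.center k (JordanDoubleLoc k) ∧
    ∃ (φ : (LaurentPolynomial k)[X] ≃ₐ[k] Subalgebra.center k (JordanDoubleLoc k))
      (e : JordanDoubleLoc k ≃ₐ[k] WeylAlgebraLoc 2 (LaurentPolynomial k)[X]),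
      (φ (C (LaurentPolynomial.T 1)) : JordanDoubleLoc k) = JordanDoubleLoc.z k ∧
      (φ X : JordanDoubleLoc k) = JordanDoubleLoc.zPrime k ∧
      ∀ a : (LaurentPolynomial k)[X],
        e (φ a : JordanDoubleLoc k)
          = algebraMap (LaurentPolynomial k)[X]
              (WeylAlgebraLoc 2 (LaurentPolynomial k)[X]) a := by
  obtain ⟨e, he⟩ := JordanDoubleLoc.exists_algEquiv_isHom k
  exact ⟨JordanDouble.isNormalElement_q k, JordanDoubleLoc.z_mul_zInv k,
    JordanDoubleLoc.zInv_mul_z k, JordanDoubleLoc.zPrime_eq k, JordanDoubleLoc.adjoin_eq_center,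
    .ofBijective _ JordanDoubleLoc.bijective_scalars, e,
    (JordanDoubleLoc.eulerSystem k).scalars_z k, (JordanDoubleLoc.eulerSystem k).scalars_X k,
    JordanDoubleLoc.algEquiv_scalars he⟩

theorem theorem4p7 (k : Type*) [Field k] [IsAlgClosed k] [CharZero k] :
    -- `q` is normal in `𝒟`
    IsNormalElement (JordanDouble.q k) ∧
    -- `z` is invertible in `𝒟′`, and the two expressions of `z'` agree
    JordanDoubleLoc.z k * JordanDoubleLoc.zInv k = 1 ∧
    JordanDoubleLoc.zInv k * JordanDoubleLoc.z k = 1 ∧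
    JordanDoubleLoc.zPrime k
      = JordanDoubleLoc.ofD k (JordanDouble.s k) * JordanDoubleLoc.qInv k ∧
    -- the center of `𝒟′` is the subalgebra generated by `z`, `z⁻¹`, `z'`
    Algebra.adjoin k {JordanDoubleLoc.z k, JordanDoubleLoc.zInv k, JordanDoubleLoc.zPrime k}
      = Subalgebra.center k (JordanDoubleLoc k) ∧
    -- this center is `S = k[T^{±1}][X]` with `T = z` and `X = z'`, and `𝒟′ ≃ A'_2(S)` over `S`
    ∃ (φ : (LaurentPolynomial k)[X] ≃ₐ[k] Subalgebra.center k (JordanDoubleLoc k))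
      (e : JordanDoubleLoc k ≃ₐ[k] WeylAlgebraLoc 2 (LaurentPolynomial k)[X]),
      (φ (C (LaurentPolynomial.T 1)) : JordanDoubleLoc k) = JordanDoubleLoc.z k ∧
      (φ X : JordanDoubleLoc k) = JordanDoubleLoc.zPrime k ∧
      ∀ a : (LaurentPolynomial k)[X],
        e (φ a : JordanDoubleLoc k)
          = algebraMap (LaurentPolynomial k)[X]
              (WeylAlgebraLoc 2 (LaurentPolynomial k)[X]) a := by
  exact theorem4p7_general k
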